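/- Let $M$ be a nonempty compact smooth $7$-manifold without boundary and let $\beta$ be a smooth $2$-form on $M$ such that $\varphi=d\beta$ is a $G_2$-structure, i.e. at every point $x$ some linear isomorphism $T_xM\cong\mathbb{R}^7$ identifies $\varphi_x$ with $$\varphi_0=dx^{123}-dx^{167}-dx^{527}-dx^{563}+dx^{415}+dx^{426}+dx^{437},\qquad dx^{ijk}=dx^i\wedge dx^j\wedge dx^k .$$ Give $M$ the Riemannian metric and the orientation that these isomorphisms pull back from the standard ones on $\mathbb{R}^7$, with Hodge star $\ast$ and volume measure $\mathrm{vol}$, and let $$\Lambda^2_7=\{\alpha\in\Lambda^2T^*M:\ast(\varphi\wedge\alpha)=2\alpha\},\qquad \Lambda^2_{14}=\{\alpha\in\Lambda^2T^*M:\ast(\varphi\wedge\alpha)=-\alpha\}.$$ Then $\beta$ can be written in exactly one way as $\beta=\beta_7+\beta_{14}$ with $\beta_7$ a section of $\Lambda^2_7$ and $\beta_{14}$ a section of $\Lambda^2_{14}$. Moreover $|\beta_7|^2$ and $|\beta_{14}|^2$ are integrable, $$2\,\|\beta_7\|_{L^2}^2=\|\beta_{14}\|_{L^2}^2,\qquad\text{where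 } \|\alpha\|_{L^2}^2=\int_M|\alpha|^2\,d\mathrm{vol},$$ and neither $\beta_7$ nor $\beta_{14}$ vanishes identically. -/

import Mathlib

open scoped Manifold ContDiff
open MeasureTheory Set

noncomputable section

namespace G2

/-! ## Multilinear algebra on a seven-dimensional real vector space -/

section LinearAlgebra

variable {V : Type*} [AddCommGroup V] [Module ℝ V]

/-- The wedge product of real-valued alternating forms (a sum over shuffles, so that
`dx¹ ∧ ⋯ ∧ dxⁿ` is the determinant). -/
def wedge {k l : ℕ} (α : V [⋀^Fin k]→ₗ[ℝ] ℝ) (β : V [⋀^Fin l]→ₗ[ℝ] ℝ) :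
    V [⋀^Fin (k + l)]→ₗ[ℝ] ℝ :=
  ((LinearMap.mul' ℝ ℝ).compAlternatingMap (α.domCoprod β)).domDomCongr finSumFinEquiv

/-- The form `dxⁱ ∧ dxʲ ∧ dxᵏ` on `ℝ⁷` (coordinates are numbered from `0` to `6`). -/
def dx (i j k : Fin 7) : (Fin 7 → ℝ) [⋀^Fin 3]→ₗ[ℝ] ℝ :=
  (Matrix.detRowAlternating (n := Fin 3) (R := ℝ)).compLinearMap (LinearMap.funLeft ℝ ℝ ![i, j, k])

/-- The model form
`φ₀ = dx¹²³ - dx¹⁶⁷ - dx⁵²⁷ - dx⁵⁶³ + dx⁴¹⁵ + dx⁴²⁶ + dx⁴³⁷` on `ℝ⁷`,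
with indices shifted by one. -/
def modelForm : (Fin 7 → ℝ) [⋀^Fin 3]→ₗ[ℝ] ℝ :=
  dx 0 1 2 - dx 0 5 6 - dx 4 1 6 - dx 4 5 2 + dx 3 0 4 + dx 3 1 5 + dx 3 2 6

/-- A basis `b` of `V` is adapted to a three-form `φ` if the coordinate isomorphism
`V ≃ ℝ⁷` of `b` pulls the model form back to `φ`. -/
def IsAdaptedFrame (φ : V [⋀^Fin 3]→ₗ[ℝ] ℝ) (b : Module.Basis (Fin 7) ℝ V) : Prop :=
  modelForm.compLinearMap (b.equivFun : V →ₗ[ℝ] (Fin 7 → ℝ)) = φ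

/-- A three-form is positive if it is identified with the model form on `ℝ⁷`
by some linear isomorphism. -/
def IsPositive (φ : V [⋀^Fin 3]→ₗ[ℝ] ℝ) : Prop :=
  ∃ b : Module.Basis (Fin 7) ℝ V, IsAdaptedFrame φ b

/-- The inner product for which `b` is an orthonormal basis. -/
def frameInner (b : Module.Basis (Fin 7) ℝ V) (v w : V) : ℝ :=
  ∑ i, b.repr v i * b.repr w i

/-- The inner product of `k`-forms for which the `b^{i₁} ∧ ⋯ ∧ b^{iₖ}`, `i₁ < ⋯ < iₖ`,
form an orthonormal basis, where `(bⁱ)` is the basis dual to `b`. -/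
def frameFormInner (b : Module.Basis (Fin 7) ℝ V) {k : ℕ} (α β : V [⋀^Fin k]→ₗ[ℝ] ℝ) : ℝ :=
  ∑ J : Fin k ↪o Fin 7, α (fun i ↦ b (J i)) * β (fun i ↦ b (J i))

/-- Insert the fixed vectors `a₁, …, aₖ` into the first `k` slots of a form of degree
`k + l`. -/
def insertFirst {k l n : ℕ} (h : k + l = n) (η : V [⋀^Fin n]→ₗ[ℝ] ℝ) (a : Fin k → V) :
    V [⋀^Fin l]→ₗ[ℝ] ℝ where
  toFun w := η.domDomCongr (finSumFinEquiv.trans (finCongr h)).symm (Sum.elim a w)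
  map_update_add' w i x y := by
    classical
    have key : ∀ z, Sum.elim a (Function.update w i z) =
        Function.update (Sum.elim a w) (Sum.inr i) z := fun z ↦ by
      rw [← Sum.elim_update_right]
    simp only [key, AlternatingMap.map_update_add]
  map_update_smul' w i c x := by
    classical
    have key : ∀ z, Sum.elim a (Function.update w i z) =
        Function.update (Sum.elim a w) (Sum.inr i) z := fun z ↦ by
      rw [← Sum.elim_update_right]
    simp only [key, AlternatingMap.map_update_smul]
  map_eq_zero_of_eq' w i j hw hij :=
    AlternatingMap.map_eq_zero_of_eq _ _ (i := Sum.inr i) (j := Sum.inr j) (by simpa using hw)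
      (by simpa using hij)

/-- The Hodge star `Λᵏ → Λˡ`, `k + l = 7`, of the inner product and the orientation for which
`b` is an oriented orthonormal basis:
`(⋆α)(w) = ∑_{i₁ < ⋯ < iₖ} α(b_{i₁}, …, b_{iₖ}) vol(b_{i₁}, …, b_{iₖ}, w)`,
so that `⋆(b^{i₁} ∧ ⋯ ∧ b^{iₖ})` completes `b^{i₁} ∧ ⋯ ∧ b^{iₖ}` to `vol = b¹ ∧ ⋯ ∧ b⁷`. -/
def frameStar (b : Module.Basis (Fin 7) ℝ V) {k l : ℕ} (h : k + l = 7)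
    (α : V [⋀^Fin k]→ₗ[ℝ] ℝ) : V [⋀^Fin l]→ₗ[ℝ] ℝ :=
  ∑ J : Fin k ↪o Fin 7, α (fun i ↦ b (J i)) • insertFirst h b.det (fun i ↦ b (J i))

/-- An adapted frame of a positive three-form. Two adapted frames differ by an element of the
stabilizer `G₂ ⊆ SO(7)` of the model form, so the inner product and the orientation given by
the frame depend only on the three-form. -/
def IsPositive.frame {φ : V [⋀^Fin 3]→ₗ[ℝ] ℝ} (h : IsPositive φ) : Module.Basis (Fin 7) ℝ V :=
  h.choose

/-- The inner product `g_φ` of a positive three-form. -/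
def IsPositive.metric {φ : V [⋀^Fin 3]→ₗ[ℝ] ℝ} (h : IsPositive φ) (v w : V) : ℝ :=
  frameInner h.frame v w

/-- The inner product that `g_φ` induces on `k`-forms. -/
def IsPositive.formInner {φ : V [⋀^Fin 3]→ₗ[ℝ] ℝ} (h : IsPositive φ) {k : ℕ}
    (α β : V [⋀^Fin k]→ₗ[ℝ] ℝ) : ℝ :=
  frameFormInner h.frame α β

/-- The Hodge star of `g_φ` and of the orientation of `φ`. -/
def IsPositive.star {φ : V [⋀^Fin 3]→ₗ[ℝ] ℝ} (h : IsPositive φ) {k l : ℕ} (hkl : k + l = 7)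
    (α : V [⋀^Fin k]→ₗ[ℝ] ℝ) : V [⋀^Fin l]→ₗ[ℝ] ℝ :=
  frameStar h.frame hkl α

/-- `α ∈ Λ²₇`, that is `⋆(φ ∧ α) = 2 α`. -/
def IsPositive.MemLambda7 {φ : V [⋀^Fin 3]→ₗ[ℝ] ℝ} (h : IsPositive φ)
    (α : V [⋀^Fin 2]→ₗ[ℝ] ℝ) : Prop :=
  h.star (k := 3 + 2) (l := 2) rfl (wedge φ α) = (2 : ℝ) • α

/-- `α ∈ Λ²₁₄`, that is `⋆(φ ∧ α) = -α`. -/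
def IsPositive.MemLambda14 {φ : V [⋀^Fin 3]→ₗ[ℝ] ℝ} (h : IsPositive φ)
    (α : V [⋀^Fin 2]→ₗ[ℝ] ℝ) : Prop :=
  h.star (k := 3 + 2) (l := 2) rfl (wedge φ α) = -α

end LinearAlgebra

/-! ## Differential forms and integration on a seven-manifold -/

section Manifold

/-- The model space of seven-manifolds without boundary. -/
abbrev E7 : Type := EuclideanSpace ℝ (Fin 7)

/-- A (not necessarily smooth) differential `k`-form on a seven-manifold. -/
abbrev DForm (M : Type*) [TopologicalSpace M] [ChartedSpace E7 M] (k : ℕ) : Type _ :=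
  (x : M) → TangentSpace (𝓡 7) x [⋀^Fin k]→L[ℝ] ℝ

variable {M : Type*} [TopologicalSpace M] [ChartedSpace E7 M]

/-- The differential at `y` of the inverse of the preferred chart at `c`: it maps the standard
basis of `ℝ⁷` to the coordinate vectors `∂₁, …, ∂₇` of the chart. -/
def chartSymmDeriv (c : M) (y : E7) :
    E7 →L[ℝ] TangentSpace (𝓡 7) ((extChartAt (𝓡 7) c).symm y) :=
  mfderiv 𝓘(ℝ, E7) (𝓡 7) (extChartAt (𝓡 7) c).symm y

/-- The differential at `x` of the preferred chart at `c`. -/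
def chartDeriv (c x : M) : TangentSpace (𝓡 7) x →L[ℝ] E7 :=
  mfderiv (𝓡 7) 𝓘(ℝ, E7) (extChartAt (𝓡 7) c) x

/-- A differential form written in the preferred chart at `c`: the pullback by the inverse
chart, a form on the chart's target in `ℝ⁷`. -/
def DForm.inChart {k : ℕ} (η : DForm M k) (c : M) (y : E7) : E7 [⋀^Fin k]→L[ℝ] ℝ :=
  (η ((extChartAt (𝓡 7) c).symm y)).compContinuousLinearMap (chartSymmDeriv c y)

/-- A form is smooth if it is smooth in the charts. -/
def DForm.IsSmooth {k : ℕ} (η : DForm M k) : Prop :=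
  ∀ c : M, ContDiffOn ℝ ∞ (DForm.inChart η c) (extChartAt (𝓡 7) c).target

/-- The exterior derivative, computed at each point in the preferred chart at that point. -/
def DForm.d {k : ℕ} (η : DForm M k) : DForm M (k + 1) := fun x ↦
  (extDeriv (DForm.inChart η x) (extChartAt (𝓡 7) x x)).compContinuousLinearMap (chartDeriv x x)

variable (M) in
/-- A `G₂`-structure on `M`: a smooth three-form that is positive at every point. -/
structure G2Structure where
  /-- The three-form of the structure. -/
  form : DForm M 3
  smooth : DForm.IsSmooth form
  positive : ∀ x, IsPositive (form x).toAlternatingMap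

variable (M) in
/-- A smooth partition of unity subordinate to the cover of `M` by the preferred charts. -/
def chartPartition [IsManifold (𝓡 7) ∞ M] [T2Space M] [SigmaCompactSpace M] :
    SmoothPartitionOfUnity M (𝓡 7) M univ :=
  (SmoothPartitionOfUnity.exists_isSubordinate_chartAt_source (𝓡 7) M).choose

/-- `√(det (g(∂ᵢ, ∂ⱼ)))` in the preferred chart at `c`. -/
def volumeDensity (g : (x : M) → TangentSpace (𝓡 7) x → TangentSpace (𝓡 7) x → ℝ)
    (c : M) (y : E7) : ℝ :=
  √(Matrix.of fun i j : Fin 7 ↦ g ((extChartAt (𝓡 7) c).symm y)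
      (chartSymmDeriv c y (EuclideanSpace.single i 1))
      (chartSymmDeriv c y (EuclideanSpace.single j 1))).det

/-- The Riemannian volume measure of a metric `g`: in a chart it has the density
`√(det (g(∂ᵢ, ∂ⱼ)))` with respect to Lebesgue measure, and the charts are put together by a
partition of unity. -/
def volumeMeasure [IsManifold (𝓡 7) ∞ M] [T2Space M] [SigmaCompactSpace M] [MeasurableSpace M]
    (g : (x : M) → TangentSpace (𝓡 7) x → TangentSpace (𝓡 7) x → ℝ) : Measure M :=
  Measure.sum fun c : M ↦
    Measure.map (extChartAt (𝓡 7) c).symm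
      ((volume.restrict (extChartAt (𝓡 7) c).target).withDensity fun y ↦
        ENNReal.ofReal
          (chartPartition M c ((extChartAt (𝓡 7) c).symm y) * volumeDensity g c y))

namespace G2Structure

/-- The pointwise squared norm `|η|²` with respect to the metric of the `G₂`-structure. -/
def normSq (Φ : G2Structure M) {k : ℕ} (η : DForm M k) (x : M) : ℝ :=
  (Φ.positive x).formInner (η x).toAlternatingMap (η x).toAlternatingMap

/-- The volume measure of the metric of the `G₂`-structure. -/
def vol [IsManifold (𝓡 7) ∞ M] [T2Space M] [SigmaCompactSpace M] [MeasurableSpace M]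
    (Φ : G2Structure M) : Measure M :=
  volumeMeasure fun x ↦ (Φ.positive x).metric

/-- `‖η‖²_{L²}`, the integral of `|η|²`. -/
def l2NormSq [IsManifold (𝓡 7) ∞ M] [T2Space M] [SigmaCompactSpace M] [MeasurableSpace M]
    (Φ : G2Structure M) {k : ℕ} (η : DForm M k) : ℝ :=
  ∫ x, Φ.normSq η x ∂Φ.vol

/-- `β = β₇ + β₁₄` is the decomposition of the two-form `β` into its components in `Λ²₇` and
`Λ²₁₄`. -/
structure IsDecomposition (Φ : G2Structure M) (β β₇ β₁₄ : DForm M 2) : Prop where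
  mem_seven : ∀ x, (Φ.positive x).MemLambda7 (β₇ x).toAlternatingMap
  mem_fourteen : ∀ x, (Φ.positive x).MemLambda14 (β₁₄ x).toAlternatingMap
  add_eq : β = β₇ + β₁₄

end G2Structure

end Manifold

end G2

end

/-! Since `d β = φ`, the six-form `β ∧ β ∧ β` satisfies `d(β ∧ β ∧ β) = 3 φ ∧ β ∧ β`, so Stokes
gives `∫ φ ∧ β ∧ β = 0` (`integral_cubic_eq_zero`). Pointwise, `φ ∧ β ∧ β = ⟨⋆(φ ∧ β), β⟩ vol =
(2|β₇|² - |β₁₄|²) vol`, because the two summands are orthogonal eigenspaces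
(`frameFormInner_add_self`). This is the norm identity. If one component vanished, both norms would
be zero, hence `β = 0` and `φ = 0`, which a positive form never is.

Algebra. In an adapted frame `b` the two-forms `ι_{b_m} φ` are orthogonal of squared length 3
(`frameFormInner_contract`), and `⋆(φ ∧ α) = ∑ ⟨ι_{b_m} φ, α⟩ ι_{b_m} φ - α`
(`IsAdaptedFrame.frameStar_wedge`). The sum is three times an orthogonal projection, so the
eigenvalues are `3 - 1 = 2` and `0 - 1 = -1`, and existence and uniqueness of the decomposition
follow.

Regularity. Adapted frames are chosen point by point, with no continuity. Seven-forms built from `φ`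
repair this: `φ ∧ ι_u φ ∧ ι_v φ` is a multiple of `⟨u, v⟩ vol`, so in a chart `D g_ij` is
continuous, where `D` is the determinant of the coordinate frame in the adapted frame. Its
determinant is `D⁷ · D² = D⁹`, so `D` is continuous (`continuousOn_frameDet_symm`), and then so are
`g` and the norms.

Stokes. With a partition of unity `ρ_c`, the forms `d(ρ_c β ∧ β ∧ β)` sum to `3 φ ∧ β ∧ β` because
`∑ dρ_c = 0`, and each integrates to zero in its own chart. Measures use `|D|` while forms use `D`;
the quotient is a locally constant sign. Seven-forms are handled as unnormalized sums over
permutations: `topForm` is `3! 2! 2! = 24` times the wedge product and `oneTopForm` is `2! 2! 2! =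
8` times, which absorbs the 3 above. -/

noncomputable section

namespace G2

/-! ### Wedge product, Hodge star and inner product as permutation sums. -/

section Algebra

variable {V : Type*} [AddCommGroup V] [Module ℝ V]

/-- The product of two multilinear forms, as a multilinear form in all the variables. -/
def tensorForm {k l : ℕ} (f : MultilinearMap ℝ (fun _ : Fin k ↦ V) ℝ)
    (g : MultilinearMap ℝ (fun _ : Fin l ↦ V) ℝ) :
    MultilinearMap ℝ (fun _ : Fin (k + l) ↦ V) ℝ :=
  ((LinearMap.mul' ℝ ℝ).compMultilinearMap (f.domCoprod g)).domDomCongr finSumFinEquiv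

theorem tensorForm_apply {k l : ℕ} (f : MultilinearMap ℝ (fun _ : Fin k ↦ V) ℝ)
    (g : MultilinearMap ℝ (fun _ : Fin l ↦ V) ℝ) (v : Fin (k + l) → V) :
    tensorForm f g v = f (fun i ↦ v (Fin.castAdd l i)) * g (fun i ↦ v (Fin.natAdd k i)) := by
  simp [tensorForm, MultilinearMap.domCoprod_apply]

/-- Every shuffle is represented by `k! l!` permutations. Summing over the full group makes it
possible to reindex by translation. -/
theorem wedge_apply_eq_sum {k l : ℕ} (α : V [⋀^Fin k]→ₗ[ℝ] ℝ) (β : V [⋀^Fin l]→ₗ[ℝ] ℝ)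
    (v : Fin (k + l) → V) :
    (k.factorial * l.factorial : ℝ) * wedge α β v = ∑ σ : Equiv.Perm (Fin (k + l)),
      (Equiv.Perm.sign σ : ℝ) * (α (fun i ↦ v (σ (Fin.castAdd l i))) *
        β (fun i ↦ v (σ (Fin.natAdd k i)))) := by
  have h := congrArg (fun η ↦ LinearMap.mul' ℝ ℝ (η (v ∘ finSumFinEquiv)))
    (MultilinearMap.domCoprod_alternization_eq α β)
  simp only [Fintype.card_fin, MultilinearMap.alternatization_apply, map_sum] at h
  rw [← Equiv.sum_comp (Equiv.permCongr finSumFinEquiv)]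
  convert h.symm using 1
  · rw [AlternatingMap.smul_apply, map_nsmul, nsmul_eq_mul, Nat.cast_mul]
    rfl
  · refine Finset.sum_congr rfl fun σ _ ↦ ?_
    rw [Equiv.Perm.sign_permCongr]
    rcases Int.units_eq_one_or (Equiv.Perm.sign σ) with h | h <;>
    simp [h, MultilinearMap.domCoprod_apply, Equiv.permCongr_apply]

theorem alternatingMap_sum_apply {ι κ : Type*} (s : Finset κ) (η : κ → V [⋀^ι]→ₗ[ℝ] ℝ)
    (w : ι → V) : (∑ c ∈ s, η c) w = ∑ c ∈ s, η c w :=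
  map_sum (⟨⟨fun η : V [⋀^ι]→ₗ[ℝ] ℝ ↦ η w, rfl⟩, fun _ _ ↦ rfl⟩ : (V [⋀^ι]→ₗ[ℝ] ℝ) →+ ℝ) η s

theorem frameStar_apply (b : Module.Basis (Fin 7) ℝ V) {k l : ℕ} (h : k + l = 7)
    (η : V [⋀^Fin k]→ₗ[ℝ] ℝ) (w : Fin l → V) :
    frameStar b h η w = ∑ J : Fin k ↪o Fin 7, η (fun i ↦ b (J i)) *
      b.det (fun i ↦ Fin.append (fun i ↦ b (J i)) w (Fin.cast h.symm i)) := by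
  rw [frameStar, alternatingMap_sum_apply]
  refine Finset.sum_congr rfl fun J _ ↦ ?_
  change η (fun i ↦ b (J i)) • b.det _ = _
  rw [smul_eq_mul]
  congr 1
  congr 1
  ext i
  obtain ⟨j, rfl⟩ := (finCongr h).surjective i
  induction j using Fin.addCases with
  | left j => simp
  | right j => simp

/-- Once `l` distinct frame vectors are inserted, `b.det` kills every index set except their
complement, so only one term of the star survives. -/
theorem frameStar_perm (b : Module.Basis (Fin 7) ℝ V) {k l : ℕ} (h : k + l = 7)
    (η : V [⋀^Fin k]→ₗ[ℝ] ℝ) (f : Equiv.Perm (Fin 7)) :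
    frameStar b h η (fun i ↦ b (f (Fin.cast h (Fin.natAdd k i)))) =
      (Equiv.Perm.sign f : ℝ) * η (fun i ↦ b (f (Fin.cast h (Fin.castAdd l i)))) := by
  classical
  set g : Fin k → Fin 7 := fun i ↦ f (Fin.cast h (Fin.castAdd l i)) with hg
  have hginj : Function.Injective g := fun i j hij ↦ by simpa [hg] using hij
  -- Sorting turns the complement into an increasing embedding. The sign of `τ` arises once from `η`
  -- and once from `b.det`, and cancels.
  set τ := Tuple.sort g
  have hmono : StrictMono (g ∘ τ) :=
    (Tuple.monotone_sort g).strictMono_of_injective (hginj.comp τ.injective)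
  set K₀ : Fin k ↪o Fin 7 := OrderEmbedding.ofStrictMono _ hmono
  have hK₀ (i) : K₀ i = g (τ i) := rfl
  rw [frameStar_apply, Finset.sum_eq_single K₀]
  · have h1 : η (fun i ↦ b (K₀ i)) = (Equiv.Perm.sign τ : ℝ) * η (fun i ↦ b (g i)) := by
      have := η.map_perm (fun i ↦ b (g i)) τ
      simp only [Function.comp_def, ← hK₀] at this
      rcases Int.units_eq_one_or (Equiv.Perm.sign τ) with h | h <;> simpa [h] using this
    set ρ : Equiv.Perm (Fin 7) :=
      (finSumFinEquiv.trans (finCongr h)).permCongr (Equiv.Perm.sumCongr τ 1) with hρ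
    have h2 : (fun i ↦ Fin.append (fun i ↦ b (K₀ i))
        (fun i ↦ b (f (Fin.cast h (Fin.natAdd k i)))) (Fin.cast h.symm i)) = b ∘ (f * ρ : _) := by
      ext i
      obtain ⟨j, rfl⟩ := (finCongr h).surjective i
      induction j using Fin.addCases with
      | left j => simp [hρ, Equiv.permCongr_apply, hK₀, hg]
      | right j => simp [hρ, Equiv.permCongr_apply]
    have h3 : Equiv.Perm.sign ρ = Equiv.Perm.sign τ := by
      rw [hρ, Equiv.Perm.sign_permCongr, Equiv.Perm.sign_sumCongr]; simp
    rw [h1, h2, b.det.map_perm, Equiv.Perm.sign_mul, h3, b.det_self]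
    rcases Int.units_eq_one_or (Equiv.Perm.sign τ) with h | h <;>
    rcases Int.units_eq_one_or (Equiv.Perm.sign f) with h' | h' <;> simp [h, h', hg]
  · intro K _ hK
    -- If `K` avoids the inserted indices, it has the range of `K₀` and hence equals it; otherwise
    -- the determinant has a repeated vector.
    by_cases hdisj : ∀ j, f (Fin.cast h (Fin.natAdd k j)) ∉ range K
    · refine absurd (OrderEmbedding.range_inj.1 ?_) hK
      have hsub : range K ⊆ range K₀ := by
        rintro _ ⟨i, rfl⟩
        obtain ⟨m, hm⟩ := f.surjective (K i)
        obtain ⟨j, rfl⟩ := (finCongr h).surjective m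
        induction j using Fin.addCases with
        | left j => exact ⟨τ.symm j, by simpa [hK₀, hg] using hm⟩
        | right j => exact absurd ⟨i, hm.symm⟩ (hdisj j)
      refine Set.eq_of_subset_of_ncard_le hsub ?_
      rw [Set.ncard_range_of_injective K.injective, Set.ncard_range_of_injective K₀.injective]
    · push Not at hdisj
      obtain ⟨j, i, hij⟩ := hdisj
      rw [b.det.map_eq_zero_of_eq _ (i := Fin.cast h (Fin.castAdd l i))
        (j := Fin.cast h (Fin.natAdd k j)) (by simp [hij]), mul_zero]
      intro hc
      have := congrArg Fin.val hc
      simp at this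
      omega
  · simp

/-- The sum over all permutations of seven points of a function of the values at two points. -/
theorem sum_perm_eq (g : Fin 7 → Fin 7 → ℝ) (hg : ∀ i, g i i = 0) :
    ∑ σ : Equiv.Perm (Fin 7), g (σ 5) (σ 6) = 120 * ∑ i, ∑ j, g i j := by
  -- The two relevant positions are moved to 0 and 1, where `decomposeFin` can split off their
  -- values one after the other. What remains is a permutation of five points, whence `5! = 120`.
  rw [← Equiv.sum_comp (Equiv.mulRight (Equiv.swap 0 5 * Equiv.swap 1 6 : Equiv.Perm (Fin 7)))]
  have h5 : (Equiv.swap 0 5 * Equiv.swap 1 6 : Equiv.Perm (Fin 7)) 5 = 0 := by decide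
  have h6 : (Equiv.swap 0 5 * Equiv.swap 1 6 : Equiv.Perm (Fin 7)) 6 = 1 := by decide
  simp only [Equiv.coe_mulRight, Equiv.Perm.mul_apply _ (_ * _), h5, h6]
  rw [← Equiv.sum_comp Equiv.Perm.decomposeFin.symm, Fintype.sum_prod_type, Finset.mul_sum]
  refine Finset.sum_congr rfl fun p _ ↦ ?_
  simp only [Equiv.Perm.decomposeFin_symm_apply_zero, Equiv.Perm.decomposeFin_symm_apply_one]
  rw [← Equiv.sum_comp Equiv.Perm.decomposeFin.symm, Fintype.sum_prod_type]
  simp only [Equiv.Perm.decomposeFin_symm_apply_zero, Finset.sum_const, Finset.card_univ,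
    Fintype.card_perm, Fintype.card_fin, ← Finset.smul_sum]
  rw [← Equiv.sum_comp (Equiv.swap 0 p) (fun j ↦ g p j), Fin.sum_univ_succ (n := 6)]
  simp [hg, Nat.factorial]

theorem frameFormInner_two (b : Module.Basis (Fin 7) ℝ V) (α γ : V [⋀^Fin 2]→ₗ[ℝ] ℝ) :
    2 * frameFormInner b α γ = ∑ i, ∑ j, α ![b i, b j] * γ ![b i, b j] := by
  set f : Fin 7 × Fin 7 → ℝ := fun p ↦ α ![b p.1, b p.2] * γ ![b p.1, b p.2] with hf
  have hswap (p : Fin 7 × Fin 7) : f p.swap = f p := by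
    have h (η : V [⋀^Fin 2]→ₗ[ℝ] ℝ) : η ![b p.2, b p.1] = -η ![b p.1, b p.2] := by
      rw [← η.map_swap _ (i := 0) (j := 1) (by decide)]
      congr 1
      ext i
      fin_cases i <;> rfl
    simp [hf, h]
  have hdiag (i : Fin 7) : f (i, i) = 0 := by
    rw [hf]
    dsimp only
    rw [α.map_eq_zero_of_eq _ (i := 0) (j := 1) (by simp) (by decide), zero_mul]
  have h1 : frameFormInner b α γ = ∑ p : Fin 7 × Fin 7 with p.1 < p.2, f p := by
    rw [frameFormInner]
    refine Finset.sum_bij' (fun J _ ↦ (J 0, J 1))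
      (fun p hp ↦ OrderEmbedding.ofStrictMono ![p.1, p.2] ?_) ?_ ?_ ?_ ?_ ?_
    · have : p.1 < p.2 := by simpa using hp
      intro i j hij
      fin_cases i <;> fin_cases j <;> simp_all
    · intro J _
      simp
    · simp
    · intro J _
      ext i
      fin_cases i <;> rfl
    · intro p _
      rfl
    · intro J _
      rw [hf]
      congr 2 <;> (ext i; fin_cases i <;> rfl)
  have h2 : ∑ p : Fin 7 × Fin 7 with p.2 < p.1, f p = ∑ p : Fin 7 × Fin 7 with p.1 < p.2, f p := by
    refine Finset.sum_nbij' Prod.swap Prod.swap ?_ ?_ ?_ ?_ ?_ <;> simp [hswap]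
  rw [← Fintype.sum_prod_type' (fun i j ↦ α ![b i, b j] * γ ![b i, b j]), h1, two_mul]
  nth_rw 2 [← h2]
  rw [Finset.sum_filter, Finset.sum_filter, ← Finset.sum_add_distrib]
  refine Finset.sum_congr rfl fun p _ ↦ ?_
  obtain ⟨i, j⟩ := p
  change _ = f (i, j)
  rcases lt_trichotomy i j with h | h | h
  · simp [h, h.not_gt]
  · subst h
    simp [hdiag]
  · simp [h, h.not_gt]

theorem frameStar_five (b : Module.Basis (Fin 7) ℝ V) (η : V [⋀^Fin 5]→ₗ[ℝ] ℝ)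
    (f : Equiv.Perm (Fin 7)) {i j : Fin 7} (hi : f 5 = i) (hj : f 6 = j) :
    frameStar b (k := 5) (l := 2) rfl η ![b i, b j] =
      (Equiv.Perm.sign f : ℝ) * η (fun k ↦ b (f (Fin.castAdd 2 k))) := by
  subst hi hj
  have := frameStar_perm b (k := 5) (l := 2) rfl η f
  refine Eq.trans ?_ this
  congr 1
  ext i
  fin_cases i <;> rfl

/-- The constant is `2 · 5!`: ordered instead of increasing pairs, times the permutations with
prescribed values at 5 and 6. -/
theorem frameFormInner_frameStar (b : Module.Basis (Fin 7) ℝ V) (η : V [⋀^Fin 5]→ₗ[ℝ] ℝ)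
    (γ : V [⋀^Fin 2]→ₗ[ℝ] ℝ) :
    240 * frameFormInner b (frameStar b (k := 5) (l := 2) rfl η) γ =
      ∑ σ : Equiv.Perm (Fin 7), (Equiv.Perm.sign σ : ℝ) *
        (η (fun i ↦ b (σ (Fin.castAdd 2 i))) * γ ![b (σ 5), b (σ 6)]) := by
  set ζ := frameStar b (k := 5) (l := 2) rfl η with hζ
  have h := frameFormInner_two b ζ γ
  have h' := sum_perm_eq (fun i j ↦ ζ ![b i, b j] * γ ![b i, b j]) fun i ↦ by
    rw [ζ.map_eq_zero_of_eq _ (i := 0) (j := 1) (by simp) (by decide), zero_mul]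
  rw [← h] at h'
  trans 120 * (2 * frameFormInner b ζ γ)
  · ring
  rw [← h']
  refine Finset.sum_congr rfl fun σ _ ↦ ?_
  rw [← mul_assoc]
  congr 1
  exact frameStar_five b η σ rfl rfl

/-- The seven-form `φ ∧ α ∧ γ`, up to normalization. -/
def topForm (φ : V [⋀^Fin 3]→ₗ[ℝ] ℝ) (α γ : V [⋀^Fin 2]→ₗ[ℝ] ℝ) : V [⋀^Fin 7]→ₗ[ℝ] ℝ :=
  MultilinearMap.alternatization (tensorForm (k := 5) (l := 2)
    (tensorForm (k := 3) (l := 2) φ.toMultilinearMap α.toMultilinearMap) γ.toMultilinearMap)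

theorem topForm_apply (φ : V [⋀^Fin 3]→ₗ[ℝ] ℝ) (α γ : V [⋀^Fin 2]→ₗ[ℝ] ℝ) (v : Fin 7 → V) :
    topForm φ α γ v = ∑ σ : Equiv.Perm (Fin 7), (Equiv.Perm.sign σ : ℝ) *
      (φ ![v (σ 0), v (σ 1), v (σ 2)] * α ![v (σ 3), v (σ 4)] * γ ![v (σ 5), v (σ 6)]) := by
  rw [topForm, MultilinearMap.alternatization_apply]
  refine Finset.sum_congr rfl fun σ _ ↦ ?_
  rw [MultilinearMap.domDomCongr_apply, tensorForm_apply, tensorForm_apply,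
    Units.smul_def, zsmul_eq_mul]
  congr 2
  · congr 1
    · change φ _ = φ _
      congr 1; ext i; fin_cases i <;> rfl
    · change α _ = α _
      congr 1; ext i; fin_cases i <;> rfl
  · change γ _ = γ _
    congr 1; ext i; fin_cases i <;> rfl

theorem permCongr_sumCongr_castAdd {k l : ℕ} (τ : Equiv.Perm (Fin k)) (τ' : Equiv.Perm (Fin l))
    (i : Fin k) : (finSumFinEquiv (m := k) (n := l)).permCongr (Equiv.Perm.sumCongr τ τ')
      (Fin.castAdd l i) = Fin.castAdd l (τ i) := by
  simp [Equiv.permCongr_apply]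

theorem permCongr_sumCongr_natAdd {k l : ℕ} (τ : Equiv.Perm (Fin k)) (τ' : Equiv.Perm (Fin l))
    (i : Fin l) : (finSumFinEquiv (m := k) (n := l)).permCongr (Equiv.Perm.sumCongr τ τ')
      (Fin.natAdd k i) = Fin.natAdd k (τ' i) := by
  simp [Equiv.permCongr_apply]

/-- This is `⟨⋆(φ ∧ α), γ⟩ vol = φ ∧ α ∧ γ`. It turns the metric quantity into a seven-form, which
can be evaluated in any frame. -/
theorem frameFormInner_frameStar_wedge (b : Module.Basis (Fin 7) ℝ V) (φ : V [⋀^Fin 3]→ₗ[ℝ] ℝ)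
    (α γ : V [⋀^Fin 2]→ₗ[ℝ] ℝ) :
    24 * frameFormInner b (frameStar b (k := 3 + 2) (l := 2) rfl (wedge φ α)) γ =
      topForm φ α γ b := by
  have h := frameFormInner_frameStar b (wedge φ α) γ
  -- Here `12 = 3! 2!` clears the normalization of the wedge, and `120 = 5!` counts the permutations
  -- `τ` in its expansion.
  suffices 12 * (240 * frameFormInner b (frameStar b (k := 3 + 2) (l := 2) rfl (wedge φ α)) γ) =
      120 * topForm φ α γ b by linarith
  rw [h, Finset.mul_sum]
  trans ∑ σ : Equiv.Perm (Fin 7), ∑ τ : Equiv.Perm (Fin (3 + 2)), (Equiv.Perm.sign σ : ℝ) *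
    ((Equiv.Perm.sign τ : ℝ) * (φ (fun i ↦ b (σ (Fin.castAdd 2 (τ (Fin.castAdd 2 i))))) *
        α (fun i ↦ b (σ (Fin.castAdd 2 (τ (Fin.natAdd 3 i))))))) * γ ![b (σ 5), b (σ 6)]
  · refine Finset.sum_congr rfl fun σ _ ↦ ?_
    have := wedge_apply_eq_sum φ α (fun i ↦ b (σ (Fin.castAdd 2 i)))
    rw [← Finset.sum_mul, ← Finset.mul_sum, ← this]
    simp [Nat.factorial]
    ring
  rw [Finset.sum_comm]
  have key (τ : Equiv.Perm (Fin (3 + 2))) : ∑ σ : Equiv.Perm (Fin 7), (Equiv.Perm.sign σ : ℝ) *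
    ((Equiv.Perm.sign τ : ℝ) * (φ (fun i ↦ b (σ (Fin.castAdd 2 (τ (Fin.castAdd 2 i))))) *
        α (fun i ↦ b (σ (Fin.castAdd 2 (τ (Fin.natAdd 3 i))))))) * γ ![b (σ 5), b (σ 6)] =
      topForm φ α γ b := by
    -- Extending `τ` by the identity on the last two places and substituting `σ ↦ σ ρ` shows that
    -- every `τ` contributes the same amount.
    set ρ : Equiv.Perm (Fin (5 + 2)) :=
      (finSumFinEquiv (m := 5) (n := 2)).permCongr (Equiv.Perm.sumCongr τ 1) with hρ
    have h3 : Equiv.Perm.sign ρ = Equiv.Perm.sign τ := by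
      rw [hρ, Equiv.Perm.sign_permCongr, Equiv.Perm.sign_sumCongr]; simp
    have hl (i : Fin 5) : ρ (Fin.castAdd 2 i) = Fin.castAdd 2 (τ i) := by
      rw [hρ, permCongr_sumCongr_castAdd]
    have hr (i : Fin 2) : ρ (Fin.natAdd 5 i) = Fin.natAdd 5 i := by
      rw [hρ, permCongr_sumCongr_natAdd, Equiv.Perm.one_apply]
    rw [topForm_apply]
    refine Eq.trans ?_ (Equiv.sum_comp (Equiv.mulRight ρ) _)
    refine Finset.sum_congr rfl fun σ _ ↦ ?_
    simp only [Equiv.coe_mulRight, Equiv.Perm.sign_mul, h3, Equiv.Perm.mul_apply]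
    rw [show ρ 5 = 5 from hr 0, show ρ 6 = 6 from hr 1, show ρ 0 = Fin.castAdd 2 (τ 0) from hl 0,
      show ρ 1 = Fin.castAdd 2 (τ 1) from hl 1, show ρ 2 = Fin.castAdd 2 (τ 2) from hl 2,
      show ρ 3 = Fin.castAdd 2 (τ 3) from hl 3, show ρ 4 = Fin.castAdd 2 (τ 4) from hl 4]
    have e1 : (fun i ↦ b (σ (Fin.castAdd 2 (τ (Fin.castAdd 2 i))))) =
        ![b (σ (Fin.castAdd 2 (τ 0))), b (σ (Fin.castAdd 2 (τ 1))),
          b (σ (Fin.castAdd 2 (τ 2)))] := by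
      ext i; fin_cases i <;> rfl
    have e2 : (fun i ↦ b (σ (Fin.castAdd 2 (τ (Fin.natAdd 3 i))))) =
        ![b (σ (Fin.castAdd 2 (τ 3))), b (σ (Fin.castAdd 2 (τ 4)))] := by
      ext i; fin_cases i <;> rfl
    rw [e1, e2]
    push_cast
    ring
  simp_rw [key]
  rw [Finset.sum_const, Finset.card_univ, Fintype.card_perm]
  simp [Nat.factorial]

end Algebra

/-! ### The model form and the operator `α ↦ ⋆(φ ∧ α)` in an adapted frame. -/

section Algebra

variable {V : Type*} [AddCommGroup V] [Module ℝ V]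

/-- Representatives of the `(3, 2)`-shuffles. -/
def shuffle : Fin 10 → Equiv.Perm (Fin 3 ⊕ Fin 2) :=
  ![1, Equiv.swap (.inl 0) (.inr 0), Equiv.swap (.inl 1) (.inr 0), Equiv.swap (.inl 2) (.inr 0),
    Equiv.swap (.inl 0) (.inr 1), Equiv.swap (.inl 1) (.inr 1), Equiv.swap (.inl 2) (.inr 1),
    Equiv.swap (.inl 0) (.inr 0) * Equiv.swap (.inl 1) (.inr 1),
    Equiv.swap (.inl 0) (.inr 0) * Equiv.swap (.inl 2) (.inr 1),
    Equiv.swap (.inl 1) (.inr 0) * Equiv.swap (.inl 2) (.inr 1)]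

/-- The listed permutations lie in distinct cosets, and there are `5! / (3! 2!) = 10` cosets, so the
list is complete. -/
theorem bijective_mk_shuffle : Function.Bijective
    (fun m ↦ (Quotient.mk'' (shuffle m) : Equiv.Perm.ModSumCongr (Fin 3) (Fin 2))) := by
  refine (Fintype.bijective_iff_injective_and_card _).2 ⟨fun m n hmn ↦ ?_, ?_⟩
  · have h := QuotientGroup.leftRel_apply.1 (Quotient.exact' hmn)
    obtain ⟨⟨σ, τ⟩, h⟩ := h
    have key : ∀ m n, (∀ i, (((shuffle m)⁻¹ * shuffle n) (.inl i)).isLeft = true) → m = n := by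
      decide +kernel
    refine key m n fun i ↦ ?_
    rw [← h]
    simp
  · rw [← Nat.card_eq_fintype_card, ← Nat.card_eq_fintype_card]
    have h := Subgroup.card_eq_card_quotient_mul_card_subgroup
      (Equiv.Perm.sumCongrHom (Fin 3) (Fin 2)).range
    have h' : Nat.card (Equiv.Perm.sumCongrHom (Fin 3) (Fin 2)).range = 12 := by
      rw [← Nat.card_congr (MonoidHom.ofInjective Equiv.Perm.sumCongrHom_injective).toEquiv]
      simp [Fintype.card_perm, Nat.factorial]
    rw [h', Nat.card_eq_fintype_card, Fintype.card_perm] at h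
    simp only [Fintype.card_sum, Fintype.card_fin, Nat.factorial] at h
    rw [Nat.card_eq_fintype_card, Fintype.card_fin]
    change 10 = Nat.card (Equiv.Perm (Fin 3 ⊕ Fin 2) ⧸ (Equiv.Perm.sumCongrHom _ _).range)
    omega

theorem wedge_apply_eq_sum_modSumCongr {k l : ℕ} (α : V [⋀^Fin k]→ₗ[ℝ] ℝ)
    (β : V [⋀^Fin l]→ₗ[ℝ] ℝ) (v : Fin (k + l) → V) :
    wedge α β v = ∑ σ : Equiv.Perm.ModSumCongr (Fin k) (Fin l), LinearMap.mul' ℝ ℝ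
      (AlternatingMap.domCoprod.summand α β σ (fun i ↦ v (finSumFinEquiv i))) := by
  change LinearMap.mul' ℝ ℝ ((α.domCoprod β) _) = _
  rw [AlternatingMap.domCoprod_apply, _root_.sum_apply, map_sum]
  rfl

/-- An expansion into ten terms, in the order of `shuffle`, short enough for an explicit check in
coordinates. -/
theorem wedge_three_two (φ : V [⋀^Fin 3]→ₗ[ℝ] ℝ) (α : V [⋀^Fin 2]→ₗ[ℝ] ℝ) (v : Fin 5 → V) :
    wedge φ α v = φ ![v 0, v 1, v 2] * α ![v 3, v 4] - φ ![v 3, v 1, v 2] * α ![v 0, v 4]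
      - φ ![v 0, v 3, v 2] * α ![v 1, v 4] - φ ![v 0, v 1, v 3] * α ![v 2, v 4]
      - φ ![v 4, v 1, v 2] * α ![v 3, v 0] - φ ![v 0, v 4, v 2] * α ![v 3, v 1]
      - φ ![v 0, v 1, v 4] * α ![v 3, v 2] + φ ![v 3, v 4, v 2] * α ![v 0, v 1]
      + φ ![v 3, v 1, v 4] * α ![v 0, v 2] + φ ![v 0, v 3, v 4] * α ![v 1, v 2] := by
  have hterm (σ : Equiv.Perm (Fin 3 ⊕ Fin 2)) : LinearMap.mul' ℝ ℝ
      (AlternatingMap.domCoprod.summand φ α (Quotient.mk'' σ) (fun i ↦ v (finSumFinEquiv i))) =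
      (Equiv.Perm.sign σ : ℝ) *
        (φ ![v (finSumFinEquiv (σ (.inl 0))), v (finSumFinEquiv (σ (.inl 1))),
          v (finSumFinEquiv (σ (.inl 2)))] *
        α ![v (finSumFinEquiv (σ (.inr 0))), v (finSumFinEquiv (σ (.inr 1)))]) := by
    have e1 : (fun i ↦ v (finSumFinEquiv (σ (.inl i)))) = ![v (finSumFinEquiv (σ (.inl 0))),
        v (finSumFinEquiv (σ (.inl 1))), v (finSumFinEquiv (σ (.inl 2)))] := by
      ext i; fin_cases i <;> rfl
    have e2 : (fun i ↦ v (finSumFinEquiv (σ (.inr i)))) = ![v (finSumFinEquiv (σ (.inr 0))),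
        v (finSumFinEquiv (σ (.inr 1)))] := by
      ext i; fin_cases i <;> rfl
    rw [AlternatingMap.domCoprod.summand_mk'', ← e1, ← e2]
    rcases Int.units_eq_one_or (Equiv.Perm.sign σ) with h | h <;>
    simp [h, MultilinearMap.domCoprod_apply]
  rw [wedge_apply_eq_sum_modSumCongr]
  refine (Equiv.sum_comp (Equiv.ofBijective _ bijective_mk_shuffle) _).symm.trans ?_
  simp only [Equiv.ofBijective_apply, hterm]
  have hsign : ∀ m, Equiv.Perm.sign (shuffle m) = ![1, -1, -1, -1, -1, -1, -1, 1, 1, 1] m := by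
    decide +kernel
  have hl : ∀ m i, finSumFinEquiv (shuffle m (.inl i)) = (![![0, 1, 2], ![3, 1, 2], ![0, 3, 2],
      ![0, 1, 3], ![4, 1, 2], ![0, 4, 2], ![0, 1, 4], ![3, 4, 2], ![3, 1, 4], ![0, 3, 4]] :
        Fin 10 → Fin 3 → Fin (3 + 2)) m i := by
    decide +kernel
  have hr : ∀ m i, finSumFinEquiv (shuffle m (.inr i)) = (![![3, 4], ![0, 4], ![1, 4],
      ![2, 4], ![3, 0], ![3, 1], ![3, 2], ![0, 1], ![0, 2], ![1, 2]] :
        Fin 10 → Fin 2 → Fin (3 + 2)) m i := by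
    decide +kernel
  simp only [hsign, hl, hr, Fin.sum_univ_succ, Fin.sum_univ_zero]
  simp
  ring

/-- The third point of the line through two points of the Fano plane. -/
def fanoThird : Fin 7 → Fin 7 → Fin 7 :=
  ![![0, 2, 1, 4, 3, 6, 5], ![2, 1, 0, 5, 6, 3, 4], ![1, 0, 2, 6, 5, 4, 3], ![4, 5, 6, 3, 0, 1, 2], ![3, 6, 5, 0, 4, 2, 1], ![6, 3, 4, 1, 2, 5, 0], ![5, 4, 3, 2, 1, 0, 6]]

/-- The signs of the model form. -/
def fanoSign : Fin 7 → Fin 7 → ℤ :=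
  ![![0, 1, -1, -1, 1, -1, 1], ![-1, 0, 1, -1, 1, 1, -1], ![1, -1, 0, -1, -1, 1, 1], ![1, 1, 1, 0, -1, -1, -1], ![-1, -1, 1, 1, 0, -1, 1], ![1, -1, -1, 1, 1, 0, -1], ![-1, 1, -1, 1, -1, 1, 0]]

/-- The values of the model form on the standard basis. -/
def modelValue (p q r : Fin 7) : ℤ :=
  if r = fanoThird p q then fanoSign p q else 0

/-- The value of `dxⁱ ∧ dxʲ ∧ dxᵏ` on a triple of standard basis vectors. -/
def dxValue (i j k p q r : Fin 7) : ℤ :=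
  let δ : Fin 7 → Fin 7 → ℤ := fun i j ↦ if i = j then 1 else 0
  δ i p * δ j q * δ k r - δ i p * δ k q * δ j r - δ j p * δ i q * δ k r + δ j p * δ k q * δ i r
    + δ k p * δ i q * δ j r - δ k p * δ j q * δ i r

/-- Working over the integers makes the comparison with the Fano tables decidable. -/
theorem sum_dxValue : ∀ p q r, dxValue 0 1 2 p q r - dxValue 0 5 6 p q r - dxValue 4 1 6 p q r -
    dxValue 4 5 2 p q r + dxValue 3 0 4 p q r + dxValue 3 1 5 p q r + dxValue 3 2 6 p q r =
    modelValue p q r := by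
  decide +kernel

theorem modelForm_single (p q r : Fin 7) :
    modelForm ![Pi.single p 1, Pi.single q 1, Pi.single r 1] = modelValue p q r := by
  have hdx (i j k : Fin 7) : dx i j k ![Pi.single p 1, Pi.single q 1, Pi.single r 1] =
      dxValue i j k p q r := by
    rw [dx, AlternatingMap.compLinearMap_apply]
    change Matrix.det (Matrix.of fun a c ↦ (![Pi.single p 1, Pi.single q 1, Pi.single r 1] :
      Fin 3 → Fin 7 → ℝ) a (![i, j, k] c)) = _
    rw [Matrix.det_fin_three]
    simp only [Matrix.of_apply, Matrix.cons_val, Pi.single_apply, dxValue]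
    push_cast
    rfl
  rw [← sum_dxValue, modelForm]
  simp only [AlternatingMap.add_apply, AlternatingMap.sub_apply, hdx]
  push_cast
  rfl

theorem IsAdaptedFrame.apply_basis {φ : V [⋀^Fin 3]→ₗ[ℝ] ℝ} {b : Module.Basis (Fin 7) ℝ V}
    (h : IsAdaptedFrame φ b) (p q r : Fin 7) : φ ![b p, b q, b r] = modelValue p q r := by
  rw [← modelForm_single, ← h, AlternatingMap.compLinearMap_apply]
  congr 1
  ext i : 1
  fin_cases i <;> simp [Finsupp.single_eq_pi_single]

/-- The contraction `ι_u φ`. -/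
def contract (φ : V [⋀^Fin 3]→ₗ[ℝ] ℝ) (u : V) : V [⋀^Fin 2]→ₗ[ℝ] ℝ := φ.curryLeft u

theorem contract_apply (φ : V [⋀^Fin 3]→ₗ[ℝ] ℝ) (u v w : V) :
    contract φ u ![v, w] = φ ![u, v, w] := rfl

/-- Each point of the Fano plane lies on three lines, so `ι_{b_p} φ` has three coefficients `±1`.
Two points determine the third on their line, so different `p` involve disjoint sets of pairs. -/
theorem frameFormInner_contract {φ : V [⋀^Fin 3]→ₗ[ℝ] ℝ} {b : Module.Basis (Fin 7) ℝ V}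
    (h : IsAdaptedFrame φ b) (p q : Fin 7) :
    frameFormInner b (contract φ (b p)) (contract φ (b q)) = if p = q then 3 else 0 := by
  suffices 2 * frameFormInner b (contract φ (b p)) (contract φ (b q)) =
      ((if p = q then 6 else 0 : ℤ) : ℝ) by
    split_ifs at this ⊢ <;> push_cast at this <;> linarith
  rw [frameFormInner_two]
  simp only [contract_apply, h.apply_basis]
  have : ∀ p q, ∑ i, ∑ j, modelValue p i j * modelValue q i j = if p = q then 6 else 0 := by
    decide +kernel
  rw [← this]
  push_cast
  rfl

set_option maxHeartbeats 1000000 in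
/-- The value of `⋆(φ ∧ α)` at a pair of vectors of an adapted frame, as a polynomial
identity in the coefficients of `α`. -/
theorem shuffle_sum (a : Fin 7 → Fin 7 → ℝ) (hanti : ∀ k l, l < k → a k l = -a l k) {i j : Fin 7}
    (hij : i < j) :
    let f : Equiv.Perm (Fin 7) := Equiv.swap i 5 * Equiv.swap (Equiv.swap i 5 j) 6
    let c : Fin 7 → Fin 7 → Fin 7 → ℝ := fun p q r ↦ modelValue (f p) (f q) (f r)
    (Equiv.Perm.sign f : ℝ) * (c 0 1 2 * a (f 3) (f 4) - c 3 1 2 * a (f 0) (f 4)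
      - c 0 3 2 * a (f 1) (f 4) - c 0 1 3 * a (f 2) (f 4) - c 4 1 2 * a (f 3) (f 0)
      - c 0 4 2 * a (f 3) (f 1) - c 0 1 4 * a (f 3) (f 2) + c 3 4 2 * a (f 0) (f 1)
      + c 3 1 4 * a (f 0) (f 2) + c 0 3 4 * a (f 1) (f 2)) =
    ∑ m, (∑ k, (fanoSign m k : ℝ) * a k (fanoThird m k) / 2) * modelValue m i j - a i j := by
  intro f c
  simp only [c, f, modelValue, Equiv.Perm.sign_mul, Equiv.Perm.sign_swap']
  fin_cases i <;> fin_cases j <;> first | exact absurd hij (by decide) | skip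
  all_goals
    simp [fanoThird, fanoSign, Fin.sum_univ_succ, Equiv.swap_apply_def, hanti]
    ring

/-- Both sides are linear in the coefficients of `α`; `shuffle_sum` compares them for each pair `i <
j`. -/
theorem frameStar_wedge_basis {φ : V [⋀^Fin 3]→ₗ[ℝ] ℝ} {b : Module.Basis (Fin 7) ℝ V}
    (h : IsAdaptedFrame φ b) (α : V [⋀^Fin 2]→ₗ[ℝ] ℝ) {i j : Fin 7} (hij : i < j) :
    frameStar b (k := 3 + 2) (l := 2) rfl (wedge φ α) ![b i, b j] =
      ∑ m, frameFormInner b (contract φ (b m)) α * φ ![b m, b i, b j] - α ![b i, b j] := by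
  -- A permutation with `5 ↦ i` and `6 ↦ j`; the inner swap undoes the effect of the outer one on
  -- `j`.
  obtain ⟨f, hf⟩ : ∃ f : Equiv.Perm (Fin 7), f =
    Equiv.swap i 5 * Equiv.swap (Equiv.swap i 5 j) 6 := ⟨_, rfl⟩
  have h5 : f 5 = i := by
    have : Equiv.swap i 5 j ≠ 5 := fun h ↦ hij.ne (by
      rw [Equiv.swap_apply_eq_iff.1 h, Equiv.swap_apply_right])
    rw [hf, Equiv.Perm.mul_apply, Equiv.swap_apply_of_ne_of_ne this.symm (by decide),
      Equiv.swap_apply_right]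
  have h6 : f 6 = j := by simp [hf]
  have hstar := frameStar_five b (wedge φ α) f h5 h6
  have hanti (k l : Fin 7) (hkl : l < k) : α ![b k, b l] = -α ![b l, b k] := by
    rw [← α.map_swap _ (i := 0) (j := 1) (by decide)]
    congr 1
    ext i : 1
    fin_cases i <;> rfl
  have hX (m : Fin 7) : frameFormInner b (contract φ (b m)) α =
      ∑ k, (fanoSign m k : ℝ) * α ![b k, b (fanoThird m k)] / 2 := by
    rw [← Finset.sum_div, eq_div_iff two_ne_zero, mul_comm, frameFormInner_two]
    refine Finset.sum_congr rfl fun k _ ↦ ?_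
    simp [contract_apply, h.apply_basis, modelValue]
  refine hstar.trans ?_
  rw [wedge_three_two]
  simp only [h.apply_basis, hX]
  subst hf
  exact shuffle_sum (fun k l ↦ α ![b k, b l]) hanti hij

end Algebra

/-! ### Eigenspaces of `⋆(φ ∧ ·)`, and metric quantities expressed in arbitrary frames. -/

section Algebra

variable {V : Type*} [AddCommGroup V] [Module ℝ V]

theorem map_vec_swap (α : V [⋀^Fin 2]→ₗ[ℝ] ℝ) (u v : V) : α ![v, u] = -α ![u, v] := by
  rw [← α.map_swap _ (i := 0) (j := 1) (by decide)]
  congr 1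
  ext i : 1
  fin_cases i <;> rfl

theorem alternatingMap_two_ext (b : Module.Basis (Fin 7) ℝ V) {α γ : V [⋀^Fin 2]→ₗ[ℝ] ℝ}
    (h : ∀ i j, i < j → α ![b i, b j] = γ ![b i, b j]) : α = γ := by
  refine Module.Basis.ext_alternating b fun v hv ↦ ?_
  have e : (fun i ↦ b (v i)) = ![b (v 0), b (v 1)] := by
    ext i : 1
    fin_cases i <;> rfl
  rw [e]
  rcases lt_or_gt_of_ne (hv.ne (show (0 : Fin 2) ≠ 1 by decide)) with hlt | hlt
  · exact h _ _ hlt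
  · rw [map_vec_swap α, map_vec_swap γ, h _ _ hlt]

/-- The bilinear form of a two-form. -/
def twoFormBilin (α : V [⋀^Fin 2]→ₗ[ℝ] ℝ) : V →ₗ[ℝ] V →ₗ[ℝ] ℝ :=
  LinearMap.mk₂ ℝ (fun u v ↦ α ![u, v]) (fun u u' v ↦ α.map_vecCons_add ![v] u u')
    (fun c u v ↦ α.map_vecCons_smul ![v] c u)
    (fun u v v' ↦ by
      simp only [map_vec_swap α _ u]
      rw [α.map_vecCons_add ![u] v v', neg_add])
    (fun c u v ↦ by
      simp only [map_vec_swap α _ u]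
      rw [α.map_vecCons_smul ![u] c v, smul_neg])

theorem twoFormBilin_apply (α : V [⋀^Fin 2]→ₗ[ℝ] ℝ) (u v : V) :
    twoFormBilin α u v = α ![u, v] := rfl

section Inner

variable (b : Module.Basis (Fin 7) ℝ V) {k : ℕ}

theorem frameFormInner_comm (α γ : V [⋀^Fin k]→ₗ[ℝ] ℝ) :
    frameFormInner b α γ = frameFormInner b γ α := by
  simp only [frameFormInner, mul_comm]

/-- The inner product of forms as a bilinear form. -/
def frameFormBilin : (V [⋀^Fin k]→ₗ[ℝ] ℝ) →ₗ[ℝ] (V [⋀^Fin k]→ₗ[ℝ] ℝ) →ₗ[ℝ] ℝ :=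
  LinearMap.mk₂ ℝ (frameFormInner b)
    (fun α α' γ ↦ by simp [frameFormInner, add_mul, Finset.sum_add_distrib])
    (fun c α γ ↦ by simp [frameFormInner, mul_assoc, Finset.mul_sum])
    (fun α γ γ' ↦ by simp [frameFormInner, mul_add, Finset.sum_add_distrib])
    (fun c α γ ↦ by simp [frameFormInner, mul_left_comm, Finset.mul_sum])

theorem frameFormBilin_apply (α γ : V [⋀^Fin k]→ₗ[ℝ] ℝ) :
    frameFormBilin b α γ = frameFormInner b α γ := rfl

theorem frameFormInner_self_nonneg (α : V [⋀^Fin k]→ₗ[ℝ] ℝ) : 0 ≤ frameFormInner b α α :=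
  Finset.sum_nonneg fun _ _ ↦ mul_self_nonneg _

theorem eq_zero_of_frameFormInner_self {α : V [⋀^Fin 2]→ₗ[ℝ] ℝ} (h : frameFormInner b α α = 0) :
    α = 0 := by
  have h2 := frameFormInner_two b α α
  rw [h, mul_zero, eq_comm, Finset.sum_eq_zero_iff_of_nonneg
    fun i _ ↦ Finset.sum_nonneg fun j _ ↦ mul_self_nonneg _] at h2
  refine alternatingMap_two_ext b fun i j _ ↦ ?_
  have := (Finset.sum_eq_zero_iff_of_nonneg fun j _ ↦ mul_self_nonneg _).1
    (h2 i (Finset.mem_univ i)) j (Finset.mem_univ j)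
  simpa using this

end Inner

/-- Three times the orthogonal projection onto the forms `ι_u φ`. -/
def contractProj (φ : V [⋀^Fin 3]→ₗ[ℝ] ℝ) (b : Module.Basis (Fin 7) ℝ V)
    (α : V [⋀^Fin 2]→ₗ[ℝ] ℝ) : V [⋀^Fin 2]→ₗ[ℝ] ℝ :=
  ∑ m, frameFormInner b (contract φ (b m)) α • contract φ (b m)

theorem contractProj_add (φ : V [⋀^Fin 3]→ₗ[ℝ] ℝ) (b : Module.Basis (Fin 7) ℝ V)
    (α γ : V [⋀^Fin 2]→ₗ[ℝ] ℝ) :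
    contractProj φ b (α + γ) = contractProj φ b α + contractProj φ b γ := by
  simp only [contractProj, ← frameFormBilin_apply, map_add, add_smul, Finset.sum_add_distrib]

theorem contractProj_smul (φ : V [⋀^Fin 3]→ₗ[ℝ] ℝ) (b : Module.Basis (Fin 7) ℝ V) (c : ℝ)
    (α : V [⋀^Fin 2]→ₗ[ℝ] ℝ) : contractProj φ b (c • α) = c • contractProj φ b α := by
  simp only [contractProj, ← frameFormBilin_apply, map_smul, smul_assoc, Finset.smul_sum]

theorem frameFormInner_contractProj (φ : V [⋀^Fin 3]→ₗ[ℝ] ℝ) (b : Module.Basis (Fin 7) ℝ V)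
    (α γ : V [⋀^Fin 2]→ₗ[ℝ] ℝ) : frameFormInner b (contractProj φ b α) γ =
      ∑ m, frameFormInner b (contract φ (b m)) α * frameFormInner b (contract φ (b m)) γ := by
  simp only [contractProj, ← frameFormBilin_apply, map_sum, map_smul, LinearMap.sum_apply,
    LinearMap.smul_apply, smul_eq_mul]

theorem contract_eq_sum (φ : V [⋀^Fin 3]→ₗ[ℝ] ℝ) (b : Module.Basis (Fin 7) ℝ V) (u : V) :
    contract φ u = ∑ m, b.repr u m • contract φ (b m) := by
  conv_lhs => rw [← b.sum_repr u]
  exact (map_sum φ.curryLeft _ _).trans (Finset.sum_congr rfl fun m _ ↦ map_smul φ.curryLeft _ _)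

namespace IsAdaptedFrame

variable {φ : V [⋀^Fin 3]→ₗ[ℝ] ℝ} {b : Module.Basis (Fin 7) ℝ V} (h : IsAdaptedFrame φ b)

include h

theorem frameStar_wedge (α : V [⋀^Fin 2]→ₗ[ℝ] ℝ) :
    frameStar b (k := 3 + 2) (l := 2) rfl (wedge φ α) = contractProj φ b α - α := by
  refine alternatingMap_two_ext b fun i j hij ↦ ?_
  rw [frameStar_wedge_basis h α hij, AlternatingMap.sub_apply, contractProj,
    alternatingMap_sum_apply]
  rfl

/-- Orthogonality of the `ι_{b_m} φ` and their squared length 3 make this operator three times a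
projection. -/
theorem contractProj_contractProj (α : V [⋀^Fin 2]→ₗ[ℝ] ℝ) :
    contractProj φ b (contractProj φ b α) = (3 : ℝ) • contractProj φ b α := by
  rw [contractProj, contractProj, Finset.smul_sum]
  refine Finset.sum_congr rfl fun m _ ↦ ?_
  rw [frameFormInner_comm]
  have := frameFormInner_contractProj φ b α (contract φ (b m))
  rw [contractProj] at this
  rw [this]
  simp [frameFormInner_contract h, smul_smul, mul_comm]

theorem mem_seven_iff {α : V [⋀^Fin 2]→ₗ[ℝ] ℝ} :
    frameStar b (k := 3 + 2) (l := 2) rfl (wedge φ α) = (2 : ℝ) • α ↔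
      contractProj φ b α = (3 : ℝ) • α := by
  rw [h.frameStar_wedge, sub_eq_iff_eq_add]
  rw [show (3 : ℝ) • α = (2 : ℝ) • α + α by module]

theorem mem_fourteen_iff {α : V [⋀^Fin 2]→ₗ[ℝ] ℝ} :
    frameStar b (k := 3 + 2) (l := 2) rfl (wedge φ α) = -α ↔ contractProj φ b α = 0 := by
  rw [h.frameStar_wedge, sub_eq_iff_eq_add]
  simp

theorem frameFormInner_contract_left (u : V) (m : Fin 7) :
    frameFormInner b (contract φ (b m)) (contract φ u) = 3 * b.repr u m := by
  rw [contract_eq_sum φ b u]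
  simp only [← frameFormBilin_apply, map_sum, map_smul]
  simp only [frameFormBilin_apply, frameFormInner_contract h, smul_eq_mul]
  simp [mul_comm]

theorem contractProj_contract (u : V) : contractProj φ b (contract φ u) = (3 : ℝ) • contract φ u := by
  rw [contractProj]
  simp only [h.frameFormInner_contract_left]
  rw [contract_eq_sum φ b u, Finset.smul_sum]
  simp only [smul_smul]

theorem frameFormInner_contract_contract (u v : V) :
    frameFormInner b (contract φ u) (contract φ v) = 3 * frameInner b u v := by
  rw [contract_eq_sum φ b u, frameInner, Finset.mul_sum]
  simp only [← frameFormBilin_apply, map_sum, map_smul, LinearMap.sum_apply, LinearMap.smul_apply]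
  simp only [frameFormBilin_apply, h.frameFormInner_contract_left, smul_eq_mul]
  exact Finset.sum_congr rfl fun m _ ↦ by ring

theorem frameFormInner_contractProj_sub (α γ : V [⋀^Fin 2]→ₗ[ℝ] ℝ) :
    24 * frameFormInner b (contractProj φ b α - α) γ = topForm φ α γ b := by
  rw [← h.frameStar_wedge]
  exact frameFormInner_frameStar_wedge b φ α γ

theorem topForm_basis (α γ : V [⋀^Fin 2]→ₗ[ℝ] ℝ) :
    topForm φ α γ b = 24 * (frameFormInner b (contractProj φ b α) γ - frameFormInner b α γ) := by
  have h' : frameFormInner b (contractProj φ b α - α) γ =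
      frameFormInner b (contractProj φ b α) γ - frameFormInner b α γ := by
    simp only [← frameFormBilin_apply, map_sub, LinearMap.sub_apply]
  rw [← h']
  exact (h.frameFormInner_contractProj_sub α γ).symm

/-- Since `ι_u φ` has eigenvalue 2, the constant is `24 · 2 · 3`. The formula recovers the metric
from `φ` alone, up to the volume form. -/
theorem topForm_contract_basis (u v : V) :
    topForm φ (contract φ u) (contract φ v) b = 144 * frameInner b u v := by
  rw [h.topForm_basis, h.contractProj_contract]
  simp only [← frameFormBilin_apply, map_smul, LinearMap.smul_apply]
  simp only [frameFormBilin_apply, h.frameFormInner_contract_contract, smul_eq_mul]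
  ring

end IsAdaptedFrame

theorem alternatingMap_eq_det_mul {ι : Type*} [Fintype ι] [DecidableEq ι]
    (b : Module.Basis ι ℝ V) (η : V [⋀^ι]→ₗ[ℝ] ℝ) (w : ι → V) : η w = b.det w * η b := by
  conv_lhs => rw [η.eq_smul_basis_det b]
  rw [AlternatingMap.smul_apply, smul_eq_mul, mul_comm]

theorem basis_det_comp_comp {ι W : Type*} [Fintype ι] [DecidableEq ι] [AddCommGroup W] [Module ℝ W]
    (b : Module.Basis ι ℝ V) (s : Module.Basis ι ℝ W) (A : W →ₗ[ℝ] W) (ψ : W →ₗ[ℝ] V) :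
    b.det (fun i ↦ ψ (A (s i))) = LinearMap.det A * b.det (fun i ↦ ψ (s i)) := by
  have h := alternatingMap_eq_det_mul s (b.det.compLinearMap ψ) (A ∘ s)
  rwa [Module.Basis.det_comp, s.det_self, mul_one] at h

theorem sevenForm_eq_det_mul (b : Module.Basis (Fin 7) ℝ V) (η : V [⋀^Fin 7]→ₗ[ℝ] ℝ)
    (w : Fin 7 → V) : η w = b.det w * η b :=
  alternatingMap_eq_det_mul b η w

theorem topForm_eq_det_mul (b : Module.Basis (Fin 7) ℝ V) (φ : V [⋀^Fin 3]→ₗ[ℝ] ℝ)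
    (α γ : V [⋀^Fin 2]→ₗ[ℝ] ℝ) (w : Fin 7 → V) :
    topForm φ α γ w = b.det w * topForm φ α γ b :=
  sevenForm_eq_det_mul b (topForm φ α γ) w

theorem det_frameInner (b : Module.Basis (Fin 7) ℝ V) (w : Fin 7 → V) :
    (Matrix.of fun i j ↦ frameInner b (w i) (w j)).det = b.det w ^ 2 := by
  have : (Matrix.of fun i j ↦ frameInner b (w i) (w j)) =
      (b.toMatrix w).transpose * b.toMatrix w := by
    ext i j
    simp [frameInner, Matrix.mul_apply, Module.Basis.toMatrix_apply]
  rw [this, Matrix.det_mul, Matrix.det_transpose, ← b.det_apply, sq]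

/-- This is `2|α|² = -tr(G⁻¹ A G⁻¹ A)` for the Gram matrix `G` and the coefficient matrix `A` of the
frame `w`. Adjugates replace inverses, at the cost of `(det G)² = (b.det w)⁴`. -/
theorem frameFormInner_mul_det (b : Module.Basis (Fin 7) ℝ V) (w : Fin 7 → V)
    (α : V [⋀^Fin 2]→ₗ[ℝ] ℝ) :
    2 * frameFormInner b α α * b.det w ^ 4 =
      -((Matrix.of fun i j ↦ frameInner b (w i) (w j)).adjugate *
        (Matrix.of fun i j ↦ α ![w i, w j]) *
        (Matrix.of fun i j ↦ frameInner b (w i) (w j)).adjugate *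
        (Matrix.of fun i j ↦ α ![w i, w j])).trace := by
  set P := b.toMatrix w with hP
  have hG : (Matrix.of fun i j ↦ frameInner b (w i) (w j)) = P.transpose * P := by
    ext i j
    simp [frameInner, Matrix.mul_apply, hP, Module.Basis.toMatrix_apply]
  set a : Matrix (Fin 7) (Fin 7) ℝ := Matrix.of fun i j ↦ α ![b i, b j] with ha
  have hA : (Matrix.of fun i j ↦ α ![w i, w j]) = P.transpose * a * P := by
    ext i j
    rw [Matrix.of_apply, ← twoFormBilin_apply, ← LinearMap.sum_repr_mul_repr_mul b b,
      Finsupp.sum_fintype _ _ (by simp), Matrix.mul_assoc, Matrix.mul_apply]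
    refine Finset.sum_congr rfl fun k _ ↦ ?_
    rw [Finsupp.sum_fintype _ _ (by simp), Matrix.mul_apply, Finset.mul_sum]
    refine Finset.sum_congr rfl fun l _ ↦ ?_
    simp only [ha, hP, Module.Basis.toMatrix_apply, twoFormBilin_apply, smul_eq_mul,
      Matrix.transpose_apply, Matrix.of_apply]
    ring
  have hdet : b.det w = P.det := b.det_apply w
  have htr : 2 * frameFormInner b α α = -(a * a).trace := by
    rw [frameFormInner_two, Matrix.trace, ← Finset.sum_neg_distrib]
    refine Finset.sum_congr rfl fun i _ ↦ ?_
    rw [Matrix.diag_apply, Matrix.mul_apply, ← Finset.sum_neg_distrib]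
    refine Finset.sum_congr rfl fun j _ ↦ ?_
    simp [ha, map_vec_swap α (b i) (b j)]
  rw [hG, hA, htr, hdet, Matrix.adjugate_mul_distrib]
  have h1 : P.transpose.adjugate * P.transpose = P.det • 1 := by
    rw [Matrix.adjugate_mul, Matrix.det_transpose]
  have h2 : P * P.adjugate = P.det • 1 := Matrix.mul_adjugate P
  have h3 : P.adjugate * P.transpose.adjugate * (P.transpose * a * P) *
      (P.adjugate * P.transpose.adjugate) * (P.transpose * a * P) =
      P.det ^ 3 • (P.adjugate * (a * a * P)) := by
    calc _ = P.adjugate * (P.transpose.adjugate * P.transpose) * a * (P * P.adjugate) *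
          (P.transpose.adjugate * P.transpose) * a * P := by simp only [Matrix.mul_assoc]
      _ = _ := by
        rw [h1, h2]
        simp only [Matrix.mul_smul, Matrix.smul_mul, Matrix.mul_one, smul_smul, Matrix.mul_assoc]
        congr 1
        ring
  rw [h3, Matrix.trace_smul, Matrix.trace_mul_comm P.adjugate, Matrix.mul_assoc (a * a), h2]
  simp only [Matrix.mul_smul, Matrix.mul_one, Matrix.trace_smul, smul_eq_mul]
  ring

end Algebra

/-! ### Chart differentials, coordinate changes and the exterior derivative. -/

section Charts

variable {M : Type*} [TopologicalSpace M] [ChartedSpace E7 M]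

/-- The inverse of the differential at `x` of the preferred chart at `c`. -/
def chartDerivInv (c x : M) : E7 →L[ℝ] TangentSpace (𝓡 7) x := (chartDeriv c x).inverse

/-- The coordinate change from the preferred chart at `c` to the one at `c'`. -/
def coordChange (c c' : M) (y : E7) : E7 :=
  extChartAt (𝓡 7) c' ((extChartAt (𝓡 7) c).symm y)

theorem eventually_mem_source {c c' : M} {y : E7} (hy : y ∈ (extChartAt (𝓡 7) c).target)
    (hy' : (extChartAt (𝓡 7) c).symm y ∈ (extChartAt (𝓡 7) c').source) :
    ∀ᶠ z in nhds y, z ∈ (extChartAt (𝓡 7) c).target ∧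
      (extChartAt (𝓡 7) c).symm z ∈ (extChartAt (𝓡 7) c').source := by
  have h := (isOpen_extChartAt_target c).mem_nhds hy
  refine Filter.Eventually.and h ?_
  exact ((continuousOn_extChartAt_symm c).continuousAt h).eventually
    ((isOpen_extChartAt_source c').mem_nhds hy')

variable [IsManifold (𝓡 7) ∞ M]

theorem isInvertible_chartDeriv {c x : M} (hx : x ∈ (extChartAt (𝓡 7) c).source) :
    (chartDeriv c x).IsInvertible :=
  have : IsManifold (𝓡 7) 1 M := IsManifold.of_le (n := ∞) (by simp)
  isInvertible_mfderiv_extChartAt hx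

theorem chartDeriv_comp_inv {c x : M} (hx : x ∈ (extChartAt (𝓡 7) c).source) :
    (chartDeriv c x).comp (chartDerivInv c x) = ContinuousLinearMap.id ℝ E7 :=
  (isInvertible_chartDeriv hx).self_comp_inverse

theorem chartDerivInv_comp {c x : M} (hx : x ∈ (extChartAt (𝓡 7) c).source) :
    (chartDerivInv c x).comp (chartDeriv c x) = ContinuousLinearMap.id ℝ _ :=
  (isInvertible_chartDeriv hx).inverse_comp_self

theorem chartSymmDeriv_eq {c : M} {y : E7} (hy : y ∈ (extChartAt (𝓡 7) c).target) :
    chartSymmDeriv c y = chartDerivInv c ((extChartAt (𝓡 7) c).symm y) := by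
  have : IsManifold (𝓡 7) 1 M := IsManifold.of_le (n := ∞) (by simp)
  have h1 := mfderivWithin_extChartAt_symm_comp_mfderiv_extChartAt (I := 𝓡 7) hy
  have h2 := mfderiv_extChartAt_comp_mfderivWithin_extChartAt_symm (I := 𝓡 7) hy
  rw [ModelWithCorners.Boundaryless.range_eq_univ, mfderivWithin_univ] at h1 h2
  rw [chartDerivInv, chartDeriv]
  exact (ContinuousLinearMap.inverse_eq h2 h1).symm

theorem inChart_eq {k : ℕ} (η : DForm M k) {c : M} {y : E7}
    (hy : y ∈ (extChartAt (𝓡 7) c).target) :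
    η.inChart c y = (η ((extChartAt (𝓡 7) c).symm y)).compContinuousLinearMap
      (chartDerivInv c ((extChartAt (𝓡 7) c).symm y)) := by
  rw [DForm.inChart, chartSymmDeriv_eq hy]

theorem contDiffAt_coordChange {c c' : M} {y : E7} (hy : y ∈ (extChartAt (𝓡 7) c).target)
    (hy' : (extChartAt (𝓡 7) c).symm y ∈ (extChartAt (𝓡 7) c').source) :
    ContDiffAt ℝ ∞ (coordChange c c') y := by
  rw [← contMDiffAt_iff_contDiffAt]
  refine ContMDiffAt.comp y (g := extChartAt (𝓡 7) c') (f := (extChartAt (𝓡 7) c).symm)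
    (contMDiffAt_extChartAt' (by simpa using hy')) ?_
  exact (contMDiffOn_extChartAt_symm c).contMDiffAt
    ((isOpen_extChartAt_target c).mem_nhds hy)

theorem fderiv_coordChange {c c' : M} {y : E7} (hy : y ∈ (extChartAt (𝓡 7) c).target)
    (hy' : (extChartAt (𝓡 7) c).symm y ∈ (extChartAt (𝓡 7) c').source) :
    fderiv ℝ (coordChange c c') y =
      (chartDeriv c' ((extChartAt (𝓡 7) c).symm y)).comp
        (chartDerivInv c ((extChartAt (𝓡 7) c).symm y)) := by
  rw [← chartSymmDeriv_eq hy, ← mfderiv_eq_fderiv]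
  refine mfderiv_comp y (g := extChartAt (𝓡 7) c') (f := (extChartAt (𝓡 7) c).symm) ?_ ?_
  · exact (contMDiffAt_extChartAt' (n := ∞) (by simpa using hy')).mdifferentiableAt (by simp)
  · exact ((contMDiffOn_extChartAt_symm (n := ∞) c).contMDiffAt
      ((isOpen_extChartAt_target c).mem_nhds hy)).mdifferentiableAt (by simp)

/-- The exterior derivative can be computed in every chart. -/
theorem inChart_d {k : ℕ} {η : DForm M k} (hη : η.IsSmooth) {c : M} {y : E7}
    (hy : y ∈ (extChartAt (𝓡 7) c).target) :
    (DForm.d η).inChart c y = extDeriv (η.inChart c) y := by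
  set x := (extChartAt (𝓡 7) c).symm y with hx
  have hxx : x ∈ (extChartAt (𝓡 7) x).source := mem_extChartAt_source x
  -- The derivative at `x` is defined in the chart at `x`. Near `y` the expression in the chart at
  -- `c` is the pullback of that one by the coordinate change, and `extDeriv` commutes with
  -- pullbacks.
  have hev : η.inChart c =ᶠ[nhds y] fun z ↦ (η.inChart x (coordChange c x z)).compContinuousLinearMap
      (fderiv ℝ (coordChange c x) z) := by
    filter_upwards [eventually_mem_source hy hxx] with z hz
    have h1 : coordChange c x z ∈ (extChartAt (𝓡 7) x).target :=
      (extChartAt (𝓡 7) x).map_source hz.2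
    have h2 : (extChartAt (𝓡 7) x).symm (coordChange c x z) = (extChartAt (𝓡 7) c).symm z :=
      (extChartAt (𝓡 7) x).left_inv hz.2
    rw [inChart_eq η hz.1, inChart_eq η h1, h2, fderiv_coordChange hz.1 hz.2]
    have h3 : chartDerivInv c ((extChartAt (𝓡 7) c).symm z) =
        (chartDerivInv x ((extChartAt (𝓡 7) c).symm z)).comp
        ((chartDeriv x ((extChartAt (𝓡 7) c).symm z)).comp
          (chartDerivInv c ((extChartAt (𝓡 7) c).symm z))) := by
      rw [← ContinuousLinearMap.comp_assoc, chartDerivInv_comp hz.2, ContinuousLinearMap.id_comp]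
    conv_lhs => rw [h3]
    rfl
  have hdiff : DifferentiableAt ℝ (η.inChart x) (coordChange c x y) := by
    have h1 : coordChange c x y ∈ (extChartAt (𝓡 7) x).target :=
      (extChartAt (𝓡 7) x).map_source hxx
    exact ((hη x).contDiffAt ((isOpen_extChartAt_target x).mem_nhds h1)).differentiableAt (by simp)
  rw [hev.extDeriv_eq, extDeriv_pullback hdiff (contDiffAt_coordChange hy hxx)
    (by simpa using (WithTop.coe_le_coe.2 le_top : ((2 : ℕ∞) : WithTop ℕ∞) ≤ ∞)), fderiv_coordChange hy hxx, inChart_eq _ hy]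
  rfl

end Charts

/-! ### Continuity of the metric and of the norms, despite pointwise chosen frames. -/

section Charts

/-- The standard basis of the model space. -/
def stdBasis : Module.Basis (Fin 7) ℝ E7 := (EuclideanSpace.basisFun (Fin 7) ℝ).toBasis

theorem stdBasis_apply (i : Fin 7) : stdBasis i = EuclideanSpace.single i 1 := by
  simp [stdBasis]

theorem continuousOn_form_apply {k : ℕ} {s : Set E7} {η : E7 → E7 [⋀^Fin k]→L[ℝ] ℝ}
    (hη : ContinuousOn η s) (v : Fin k → E7) : ContinuousOn (fun y ↦ η y v) s :=
  (ContinuousAlternatingMap.apply ℝ E7 ℝ v).continuous.comp_continuousOn hη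

theorem continuousOn_topForm {s : Set E7} {φ : E7 → E7 [⋀^Fin 3]→L[ℝ] ℝ}
    {α γ : E7 → E7 [⋀^Fin 2]→L[ℝ] ℝ} (hφ : ContinuousOn φ s) (hα : ContinuousOn α s)
    (hγ : ContinuousOn γ s) (v : Fin 7 → E7) :
    ContinuousOn (fun y ↦ topForm (φ y).toAlternatingMap (α y).toAlternatingMap
      (γ y).toAlternatingMap v) s := by
  simp only [topForm_apply]
  exact continuousOn_finsetSum _ fun σ _ ↦ continuousOn_const.mul
    (((continuousOn_form_apply hφ _).mul (continuousOn_form_apply hα _)).mul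
      (continuousOn_form_apply hγ _))

theorem continuous_matrix_det {ι : Type*} [Fintype ι] [DecidableEq ι] :
    Continuous (Matrix.det : Matrix ι ι ℝ → ℝ) := continuous_id.matrix_det

/-- An odd power is a homeomorphism of the real line. -/
theorem continuousOn_of_odd_pow {X : Type*} [TopologicalSpace X] {s : Set X} {f : X → ℝ} {n : ℕ}
    (hn : Odd n) (h : ContinuousOn (fun x ↦ f x ^ n) s) : ContinuousOn f s := by
  have hmono : StrictMono (fun x : ℝ ↦ x ^ n) := hn.strictMono_pow
  have htop : Filter.Tendsto (fun x : ℝ ↦ x ^ n) Filter.atTop Filter.atTop :=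
    Filter.tendsto_pow_atTop hn.pos.ne'
  have hsurj : Function.Surjective (fun x : ℝ ↦ x ^ n) := by
    refine (continuous_pow n).surjective htop ?_
    have := Filter.tendsto_neg_atTop_atBot.comp (htop.comp Filter.tendsto_neg_atBot_atTop)
    simpa [Function.comp_def, hn.neg_pow] using this
  have := (hmono.orderIsoOfSurjective _ hsurj).toHomeomorph.symm.continuous.comp_continuousOn h
  refine this.congr fun x _ ↦ ?_
  exact ((hmono.orderIsoOfSurjective _ hsurj).symm_apply_apply (f x)).symm

variable {M : Type*} [TopologicalSpace M] [ChartedSpace E7 M]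

theorem DForm.IsSmooth.continuousOn {k : ℕ} {η : DForm M k} (hη : η.IsSmooth) (c : M) :
    ContinuousOn (η.inChart c) (extChartAt (𝓡 7) c).target := (hη c).continuousOn

/-- The contraction with a constant vector in the model space. -/
theorem continuousOn_topForm_contract {s : Set E7} {φ : E7 → E7 [⋀^Fin 3]→L[ℝ] ℝ}
    (hφ : ContinuousOn φ s) (u u' : E7) (v : Fin 7 → E7) :
    ContinuousOn (fun y ↦ topForm (φ y).toAlternatingMap (contract (φ y).toAlternatingMap u)
      (contract (φ y).toAlternatingMap u') v) s := by
  simp only [topForm_apply, contract_apply]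
  exact continuousOn_finsetSum _ fun σ _ ↦ continuousOn_const.mul
    (((continuousOn_form_apply hφ _).mul (continuousOn_form_apply hφ _)).mul
      (continuousOn_form_apply hφ _))

namespace G2Structure

variable (Φ : G2Structure M)

/-- The coordinate vector fields of the preferred chart at `c`. -/
def coordFrame (c x : M) (i : Fin 7) : TangentSpace (𝓡 7) x := chartDerivInv c x (stdBasis i)

/-- The determinant of the coordinate frame with respect to an adapted frame. -/
def frameDet (c x : M) : ℝ := (Φ.positive x).frame.det (coordFrame c x)

theorem isAdaptedFrame (x : M) :
    IsAdaptedFrame (Φ.form x).toAlternatingMap (Φ.positive x).frame := (Φ.positive x).choose_spec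

variable [IsManifold (𝓡 7) ∞ M]

theorem frameDet_ne_zero {c x : M} (hx : x ∈ (extChartAt (𝓡 7) c).source) :
    Φ.frameDet c x ≠ 0 := by
  let L : TangentSpace (𝓡 7) x ≃ₗ[ℝ] E7 := LinearEquiv.ofLinearMap (chartDeriv c x).toLinearMap
    (chartDerivInv c x).toLinearMap
    (LinearMap.ext fun v ↦ DFunLike.congr_fun (chartDeriv_comp_inv hx) v)
    (LinearMap.ext fun v ↦ DFunLike.congr_fun (chartDerivInv_comp hx) v)
  have := ((Φ.positive x).frame.isUnit_det (stdBasis.map L.symm)).ne_zero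
  have e : coordFrame c x = stdBasis.map L.symm := by
    ext i : 1
    rw [Module.Basis.map_apply]
    rfl
  rwa [frameDet, e]

/-- The factor is the Jacobian of the coordinate change; this makes the integral in a chart
independent of the chart. -/
theorem frameDet_coordChange {c c' x : M} (hx' : x ∈ (extChartAt (𝓡 7) c').source) :
    Φ.frameDet c x =
      ((chartDeriv c' x).comp (chartDerivInv c x)).det * Φ.frameDet c' x := by
  set A : E7 →L[ℝ] E7 := (chartDeriv c' x).comp (chartDerivInv c x) with hA
  have h3 : (chartDerivInv c' x).comp A = chartDerivInv c x := by
    rw [hA, ← ContinuousLinearMap.comp_assoc, chartDerivInv_comp hx', ContinuousLinearMap.id_comp]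
  have h4 : coordFrame c x = fun i ↦ chartDerivInv c' x (A (stdBasis i)) :=
    funext fun i ↦ (DFunLike.congr_fun h3 (stdBasis i)).symm
  rw [frameDet, h4]
  exact basis_det_comp_comp (Φ.positive x).frame stdBasis A.toLinearMap
    (chartDerivInv c' x).toLinearMap

theorem volumeDensity_eq {c : M} {y : E7} (hy : y ∈ (extChartAt (𝓡 7) c).target) :
    volumeDensity (fun x ↦ (Φ.positive x).metric) c y =
      |Φ.frameDet c ((extChartAt (𝓡 7) c).symm y)| := by
  rw [volumeDensity, ← Real.sqrt_sq_eq_abs, frameDet, ← det_frameInner]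
  congr 3
  ext i j
  rw [chartSymmDeriv_eq hy, ← stdBasis_apply, ← stdBasis_apply]
  rfl

/-- The left side does not mention the chosen frame, so it inherits continuity from the coefficients
of the forms. -/
theorem topForm_inChart (α γ : DForm M 2) {c : M} {y : E7}
    (hy : y ∈ (extChartAt (𝓡 7) c).target) :
    topForm (Φ.form.inChart c y).toAlternatingMap (α.inChart c y).toAlternatingMap
      (γ.inChart c y).toAlternatingMap stdBasis =
    Φ.frameDet c ((extChartAt (𝓡 7) c).symm y) *
      topForm (Φ.form ((extChartAt (𝓡 7) c).symm y)).toAlternatingMap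
        (α ((extChartAt (𝓡 7) c).symm y)).toAlternatingMap
        (γ ((extChartAt (𝓡 7) c).symm y)).toAlternatingMap
        (Φ.positive ((extChartAt (𝓡 7) c).symm y)).frame := by
  rw [frameDet, ← topForm_eq_det_mul, inChart_eq _ hy, inChart_eq _ hy, inChart_eq _ hy,
    topForm_apply, topForm_apply]
  refine Finset.sum_congr rfl fun σ _ ↦ ?_
  congr 2
  · congr 1
    · change Φ.form _ _ = Φ.form _ _
      congr 1; ext i : 1; fin_cases i <;> rfl
    · change α _ _ = α _ _
      congr 1; ext i : 1; fin_cases i <;> rfl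
  · change γ _ _ = γ _ _
    congr 1; ext i : 1; fin_cases i <;> rfl

theorem topForm_contract_inChart {c : M} {y : E7}
    (hy : y ∈ (extChartAt (𝓡 7) c).target) (i j : Fin 7) :
    topForm (Φ.form.inChart c y).toAlternatingMap
      (contract (Φ.form.inChart c y).toAlternatingMap (stdBasis i))
      (contract (Φ.form.inChart c y).toAlternatingMap (stdBasis j)) stdBasis =
    144 * Φ.frameDet c ((extChartAt (𝓡 7) c).symm y) *
      (Φ.positive ((extChartAt (𝓡 7) c).symm y)).metric
        (coordFrame c ((extChartAt (𝓡 7) c).symm y) i)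
        (coordFrame c ((extChartAt (𝓡 7) c).symm y) j) := by
  have h := (Φ.isAdaptedFrame ((extChartAt (𝓡 7) c).symm y)).topForm_contract_basis
    (coordFrame c ((extChartAt (𝓡 7) c).symm y) i) (coordFrame c ((extChartAt (𝓡 7) c).symm y) j)
  rw [IsPositive.metric, mul_comm 144, mul_assoc, ← h, frameDet, ← topForm_eq_det_mul,
    inChart_eq _ hy, topForm_apply, topForm_apply]
  refine Finset.sum_congr rfl fun σ _ ↦ ?_
  simp only [contract_apply]
  congr 2
  · congr 1
    · change Φ.form _ _ = Φ.form _ _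
      congr 1; ext i : 1; fin_cases i <;> rfl
    · change Φ.form _ _ = Φ.form _ _
      congr 1; ext i : 1; fin_cases i <;> rfl
  · change Φ.form _ _ = Φ.form _ _
    congr 1; ext i : 1; fin_cases i <;> rfl

/-- The Gram matrix of the coordinate frame. -/
def gram (c x : M) : Matrix (Fin 7) (Fin 7) ℝ :=
  Matrix.of fun i j ↦ (Φ.positive x).metric (coordFrame c x i) (coordFrame c x j)

theorem continuousOn_frameDet_mul_gram (c : M) (i j : Fin 7) :
    ContinuousOn (fun y ↦ Φ.frameDet c ((extChartAt (𝓡 7) c).symm y) *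
      Φ.gram c ((extChartAt (𝓡 7) c).symm y) i j) (extChartAt (𝓡 7) c).target := by
  have h := (continuousOn_topForm_contract (Φ.smooth.continuousOn c) (stdBasis i) (stdBasis j)
    stdBasis).const_smul (144⁻¹ : ℝ)
  refine h.congr fun y hy ↦ ?_
  simp only [Pi.smul_apply]
  rw [Φ.topForm_contract_inChart hy, gram, Matrix.of_apply, smul_eq_mul]
  ring

/-- The determinant of the continuous matrix `D g_ij` is `D⁷ · D² = D⁹`, and the ninth root is
continuous on the whole line. Thus even the sign of `D` is controlled. -/
theorem continuousOn_frameDet_symm (c : M) :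
    ContinuousOn (fun y ↦ Φ.frameDet c ((extChartAt (𝓡 7) c).symm y))
      (extChartAt (𝓡 7) c).target := by
  refine continuousOn_of_odd_pow (n := 9) (by decide) ?_
  have h : ContinuousOn (fun y ↦ Φ.frameDet c ((extChartAt (𝓡 7) c).symm y) •
      Φ.gram c ((extChartAt (𝓡 7) c).symm y)) (extChartAt (𝓡 7) c).target :=
    continuousOn_pi.2 fun i ↦ continuousOn_pi.2 fun j ↦ Φ.continuousOn_frameDet_mul_gram c i j
  refine (continuous_matrix_det.comp_continuousOn h).congr fun y hy ↦ ?_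
  rw [Function.comp_apply, Matrix.det_smul, gram]
  unfold IsPositive.metric
  rw [det_frameInner, Fintype.card_fin]
  change _ = _ * Φ.frameDet c _ ^ 2
  ring

theorem continuousOn_gram (c : M) (i j : Fin 7) :
    ContinuousOn (fun y ↦ Φ.gram c ((extChartAt (𝓡 7) c).symm y) i j)
      (extChartAt (𝓡 7) c).target := by
  refine ((Φ.continuousOn_frameDet_mul_gram c i j).div (Φ.continuousOn_frameDet_symm c)
    fun y hy ↦ Φ.frameDet_ne_zero ((extChartAt (𝓡 7) c).map_target hy)).congr fun y hy ↦ ?_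
  simp only [Pi.div_apply]
  rw [mul_div_cancel_left₀ _ (Φ.frameDet_ne_zero ((extChartAt (𝓡 7) c).map_target hy))]

omit [IsManifold (𝓡 7) ∞ M] in
theorem continuous_of_continuousOn_symm {h : M → ℝ}
    (hc : ∀ c, ContinuousOn (fun y ↦ h ((extChartAt (𝓡 7) c).symm y)) (extChartAt (𝓡 7) c).target) :
    Continuous h := by
  rw [continuous_iff_continuousAt]
  intro x
  have h1 := (hc x).comp (continuousOn_extChartAt (I := 𝓡 7) x) (extChartAt (𝓡 7) x).mapsTo
  refine (h1.congr fun z hz ↦ ?_).continuousAt (extChartAt_source_mem_nhds x)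
  simp only [Function.comp_apply]
  rw [(extChartAt (𝓡 7) x).left_inv hz]

theorem continuous_of_frameDet_mul {h : M → ℝ} (hc : ∀ c, ContinuousOn
    (fun y ↦ Φ.frameDet c ((extChartAt (𝓡 7) c).symm y) * h ((extChartAt (𝓡 7) c).symm y))
      (extChartAt (𝓡 7) c).target) : Continuous h := by
  refine continuous_of_continuousOn_symm fun c ↦ ?_
  refine ((hc c).div (Φ.continuousOn_frameDet_symm c)
    fun y hy ↦ Φ.frameDet_ne_zero ((extChartAt (𝓡 7) c).map_target hy)).congr fun y hy ↦ ?_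
  simp only [Pi.div_apply]
  rw [mul_div_cancel_left₀ _ (Φ.frameDet_ne_zero ((extChartAt (𝓡 7) c).map_target hy))]

/-- The function `⟨⋆(φ ∧ β), β⟩`, up to the factor `24`. -/
def cubic (β : DForm M 2) (x : M) : ℝ :=
  topForm (Φ.form x).toAlternatingMap (β x).toAlternatingMap (β x).toAlternatingMap
    (Φ.positive x).frame

theorem continuous_cubic {β : DForm M 2} (hβ : β.IsSmooth) : Continuous (Φ.cubic β) := by
  refine Φ.continuous_of_frameDet_mul fun c ↦ ?_
  refine (continuousOn_topForm (Φ.smooth.continuousOn c) (hβ.continuousOn c) (hβ.continuousOn c)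
    stdBasis).congr fun y hy ↦ ?_
  exact (Φ.topForm_inChart β β hy).symm

/-- By `frameFormInner_mul_det` the norm is a rational expression in the coefficients of `β`, the
Gram matrix and `D`, with denominator `2 D⁴ ≠ 0`. -/
theorem continuous_normSq {β : DForm M 2} (hβ : β.IsSmooth) : Continuous (Φ.normSq β) := by
  refine continuous_of_continuousOn_symm fun c ↦ ?_
  have hA : ContinuousOn (fun y ↦ (Matrix.of fun i j ↦ β.inChart c y ![stdBasis i, stdBasis j] :
      Matrix (Fin 7) (Fin 7) ℝ)) (extChartAt (𝓡 7) c).target :=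
    continuousOn_pi.2 fun i ↦ continuousOn_pi.2 fun j ↦
      continuousOn_form_apply (hβ.continuousOn c) _
  have hG : ContinuousOn (fun y ↦ (Φ.gram c ((extChartAt (𝓡 7) c).symm y)).adjugate)
      (extChartAt (𝓡 7) c).target := by
    refine Continuous.comp_continuousOn (g := Matrix.adjugate) continuous_id.matrix_adjugate ?_
    exact continuousOn_pi.2 fun i ↦ continuousOn_pi.2 fun j ↦ Φ.continuousOn_gram c i j
  have hD := Φ.continuousOn_frameDet_symm c
  have hcont : Continuous fun p : Matrix (Fin 7) (Fin 7) ℝ × Matrix (Fin 7) (Fin 7) ℝ ↦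
      (p.1 * p.2 * p.1 * p.2).trace :=
    (((continuous_fst.matrix_mul continuous_snd).matrix_mul continuous_fst).matrix_mul
      continuous_snd).matrix_trace
  have hprod := (hcont.comp_continuousOn (hG.prodMk hA)).neg.div
      ((hD.pow 4).const_smul (2 : ℝ)) (fun y hy ↦ by
        simpa using Φ.frameDet_ne_zero ((extChartAt (𝓡 7) c).map_target hy))
  refine hprod.congr fun y hy ↦ ?_
  have hne := Φ.frameDet_ne_zero ((extChartAt (𝓡 7) c).map_target hy)
  have h := frameFormInner_mul_det (Φ.positive ((extChartAt (𝓡 7) c).symm y)).frame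
    (coordFrame c ((extChartAt (𝓡 7) c).symm y))
    (β ((extChartAt (𝓡 7) c).symm y)).toAlternatingMap
  have hA' : (Matrix.of fun i j ↦ (β ((extChartAt (𝓡 7) c).symm y)).toAlternatingMap
      ![coordFrame c ((extChartAt (𝓡 7) c).symm y) i,
        coordFrame c ((extChartAt (𝓡 7) c).symm y) j]) =
      (Matrix.of fun i j ↦ β.inChart c y ![stdBasis i, stdBasis j] :
      Matrix (Fin 7) (Fin 7) ℝ) := by
    ext i j
    rw [inChart_eq _ hy]
    change β _ _ = β _ _
    congr 1; ext i : 1; fin_cases i <;> rfl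
  rw [hA'] at h
  simp only [Pi.div_apply, Pi.neg_apply, Function.comp_apply]
  rw [eq_div_iff (by simpa using hne)]
  refine Eq.trans ?_ h
  simp only [Pi.smul_apply, smul_eq_mul]
  change normSq Φ β _ * (2 * frameDet Φ c _ ^ 4) =
    2 * normSq Φ β _ * frameDet Φ c _ ^ 4
  ring

end G2Structure

end Charts

/-! ### Integration against the volume measure. -/

section Volume

variable {M : Type*} [TopologicalSpace M] [ChartedSpace E7 M] [IsManifold (𝓡 7) ∞ M]
  [T2Space M] [CompactSpace M]

theorem tsupport_chartPartition (c : M) :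
    tsupport (chartPartition M c) ⊆ (extChartAt (𝓡 7) c).source := by
  rw [extChartAt_source]
  exact (SmoothPartitionOfUnity.exists_isSubordinate_chartAt_source (𝓡 7) M).choose_spec c

variable (M) in
theorem finite_chartPartition_ne_zero :
    {c : M | (Function.support (chartPartition M c)).Nonempty}.Finite :=
  (chartPartition M).locallyFinite.finite_nonempty_of_compact

variable (M) in
/-- The indices of the charts that contribute to the partition of unity. -/
def chartIndex : Finset M := (finite_chartPartition_ne_zero M).toFinset

theorem chartPartition_eq_zero {c : M} (hc : c ∉ chartIndex M) (x : M) :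
    chartPartition M c x = 0 := by
  by_contra h
  exact hc ((finite_chartPartition_ne_zero M).mem_toFinset.2 ⟨x, h⟩)

theorem sum_chartPartition (x : M) : ∑ c ∈ chartIndex M, chartPartition M c x = 1 := by
  refine (chartPartition M).sum_finsupport' x (mem_univ x) fun c hc ↦ ?_
  by_contra h
  exact (SmoothPartitionOfUnity.mem_finsupport _ _).1 hc (chartPartition_eq_zero h x)

theorem continuous_chartPartition (c : M) : Continuous (chartPartition M c) :=
  (chartPartition M c).contMDiff.continuous

namespace G2Structure

variable (Φ : G2Structure M)

/-- The integral of a function, supported in the preferred chart at `c`, in that chart. -/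
def chartIntegral (c : M) (h : M → ℝ) : ℝ :=
  ∫ y in (extChartAt (𝓡 7) c).target,
    |Φ.frameDet c ((extChartAt (𝓡 7) c).symm y)| * h ((extChartAt (𝓡 7) c).symm y)

omit [T2Space M] [CompactSpace M] in
theorem continuousOn_chartIntegrand (c : M) {h : M → ℝ} (hh : Continuous h) :
    ContinuousOn (fun y ↦ |Φ.frameDet c ((extChartAt (𝓡 7) c).symm y)| *
      h ((extChartAt (𝓡 7) c).symm y)) (extChartAt (𝓡 7) c).target :=
  (Φ.continuousOn_frameDet_symm c).abs.mul
    (hh.comp_continuousOn (continuousOn_extChartAt_symm c))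

omit [IsManifold (𝓡 7) ∞ M] [T2Space M] in
theorem isCompact_image_tsupport (c : M) {h : M → ℝ}
    (hs : tsupport h ⊆ (extChartAt (𝓡 7) c).source) :
    IsCompact (extChartAt (𝓡 7) c '' tsupport h) :=
  (isClosed_tsupport h).isCompact.image_of_continuousOn ((continuousOn_extChartAt c).mono hs)

omit [IsManifold (𝓡 7) ∞ M] [T2Space M] [CompactSpace M] in
theorem eq_zero_of_notMem_image_tsupport {c : M} {h : M → ℝ} {y : E7}
    (hy : y ∈ (extChartAt (𝓡 7) c).target) (hy' : y ∉ extChartAt (𝓡 7) c '' tsupport h) :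
    h ((extChartAt (𝓡 7) c).symm y) = 0 := by
  by_contra hne
  exact hy' ⟨_, subset_tsupport h hne, (extChartAt (𝓡 7) c).right_inv hy⟩

omit [T2Space M] in
theorem integrableOn_chartIntegrand (c : M) {h : M → ℝ} (hh : Continuous h)
    (hs : tsupport h ⊆ (extChartAt (𝓡 7) c).source) :
    IntegrableOn (fun y ↦ |Φ.frameDet c ((extChartAt (𝓡 7) c).symm y)| *
      h ((extChartAt (𝓡 7) c).symm y)) (extChartAt (𝓡 7) c).target := by
  have hK := isCompact_image_tsupport c hs
  have hKT : extChartAt (𝓡 7) c '' tsupport h ⊆ (extChartAt (𝓡 7) c).target := by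
    rintro _ ⟨x, hx, rfl⟩
    exact (extChartAt (𝓡 7) c).map_source (hs hx)
  refine (((Φ.continuousOn_chartIntegrand c hh).mono hKT).integrableOn_compact
    hK).of_forall_sdiff_eq_zero (isOpen_extChartAt_target c).measurableSet fun y hy ↦ ?_
  rw [eq_zero_of_notMem_image_tsupport hy.1 hy.2, mul_zero]

omit [T2Space M] [CompactSpace M] in
/-- The integral in a chart does not depend on the chart. -/
theorem chartIntegral_eq {c c' : M} {h : M → ℝ} (hc : ∀ x ∉ (extChartAt (𝓡 7) c).source, h x = 0)
    (hc' : ∀ x ∉ (extChartAt (𝓡 7) c').source, h x = 0) :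
    Φ.chartIntegral c h = Φ.chartIntegral c' h := by
  -- The overlap of the two charts, seen in the chart at `c`. Outside it `h` vanishes, so both
  -- integrals reduce to it and the change of variables formula applies.
  set s := (extChartAt (𝓡 7) c).target ∩ (extChartAt (𝓡 7) c).symm ⁻¹' (extChartAt (𝓡 7) c').source
    with hs
  have hso : IsOpen s := (continuousOn_extChartAt_symm c).isOpen_inter_preimage
    (isOpen_extChartAt_target c) (isOpen_extChartAt_source c')
  have hinv : ∀ y ∈ s, (extChartAt (𝓡 7) c').symm (coordChange c c' y) =
      (extChartAt (𝓡 7) c).symm y := fun y hy ↦ (extChartAt (𝓡 7) c').left_inv hy.2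
  have hinj : InjOn (coordChange c c') s := fun y hy z hz hyz ↦ by
    have : (extChartAt (𝓡 7) c).symm y = (extChartAt (𝓡 7) c).symm z := by
      rw [← hinv y hy, ← hinv z hz, hyz]
    exact (extChartAt (𝓡 7) c).symm.injOn hy.1 hz.1 this
  have himg : coordChange c c' '' s ⊆ (extChartAt (𝓡 7) c').target := by
    rintro _ ⟨y, hy, rfl⟩
    exact (extChartAt (𝓡 7) c').map_source hy.2
  have hderiv : ∀ y ∈ s, HasFDerivWithinAt (coordChange c c')
      (fderiv ℝ (coordChange c c') y) s y := fun y hy ↦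
    ((contDiffAt_coordChange hy.1 hy.2).differentiableAt
      (by simp)).hasFDerivAt.hasFDerivWithinAt
  have key := integral_image_eq_integral_abs_det_fderiv_smul volume hso.measurableSet hderiv hinj
    fun y ↦ |Φ.frameDet c' ((extChartAt (𝓡 7) c').symm y)| * h ((extChartAt (𝓡 7) c').symm y)
  rw [chartIntegral, chartIntegral]
  rw [setIntegral_eq_of_subset_of_forall_sdiff_eq_zero (isOpen_extChartAt_target c).measurableSet
    (inter_subset_left : s ⊆ _), setIntegral_eq_of_subset_of_forall_sdiff_eq_zero
    (isOpen_extChartAt_target c').measurableSet himg, key]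
  · refine setIntegral_congr_fun hso.measurableSet fun y hy ↦ ?_
    simp only [smul_eq_mul]
    rw [hinv y hy, fderiv_coordChange hy.1 hy.2, Φ.frameDet_coordChange hy.2, abs_mul, mul_assoc]
  · rintro z ⟨hz, hzs⟩
    rw [hc, mul_zero]
    intro hzc
    refine hzs ⟨extChartAt (𝓡 7) c ((extChartAt (𝓡 7) c').symm z), ⟨?_, ?_⟩, ?_⟩
    · exact (extChartAt (𝓡 7) c).map_source hzc
    · rw [mem_preimage, (extChartAt (𝓡 7) c).left_inv hzc]
      exact (extChartAt (𝓡 7) c').map_target hz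
    · rw [coordChange, (extChartAt (𝓡 7) c).left_inv hzc, (extChartAt (𝓡 7) c').right_inv hz]
  · rintro z ⟨hz, hzs⟩
    rw [hc', mul_zero]
    exact fun hz' ↦ hzs ⟨hz, hz'⟩

variable [MeasurableSpace M] [BorelSpace M]

/-- The contribution of the preferred chart at `c` to the volume measure. -/
def chartVol (c : M) : Measure M :=
  Measure.map (extChartAt (𝓡 7) c).symm
    ((volume.restrict (extChartAt (𝓡 7) c).target).withDensity fun y ↦
      ENNReal.ofReal (chartPartition M c ((extChartAt (𝓡 7) c).symm y) *
        volumeDensity (fun x ↦ (Φ.positive x).metric) c y))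

omit [IsManifold (𝓡 7) ∞ M] [T2Space M] [CompactSpace M] in
theorem aemeasurable_extChartAt_symm (c : M) : AEMeasurable (extChartAt (𝓡 7) c).symm
    (volume.restrict (extChartAt (𝓡 7) c).target) :=
  (continuousOn_extChartAt_symm c).aemeasurable (isOpen_extChartAt_target c).measurableSet

omit [MeasurableSpace M] [BorelSpace M] in
theorem chartDensity_ae_eq (c : M) :
    (fun y ↦ ENNReal.ofReal (chartPartition M c ((extChartAt (𝓡 7) c).symm y) *
        volumeDensity (fun x ↦ (Φ.positive x).metric) c y))
      =ᵐ[volume.restrict (extChartAt (𝓡 7) c).target]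
    fun y ↦ ENNReal.ofReal (|Φ.frameDet c ((extChartAt (𝓡 7) c).symm y)| *
      chartPartition M c ((extChartAt (𝓡 7) c).symm y)) := by
  filter_upwards [ae_restrict_mem (isOpen_extChartAt_target c).measurableSet] with y hy
  rw [Φ.volumeDensity_eq hy, mul_comm]

omit [BorelSpace M] in
theorem chartVol_eq (c : M) : Φ.chartVol c = Measure.map (extChartAt (𝓡 7) c).symm
    ((volume.restrict (extChartAt (𝓡 7) c).target).withDensity fun y ↦
      ENNReal.ofReal (|Φ.frameDet c ((extChartAt (𝓡 7) c).symm y)| *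
      chartPartition M c ((extChartAt (𝓡 7) c).symm y))) := by
  rw [chartVol, withDensity_congr_ae (Φ.chartDensity_ae_eq c)]

omit [MeasurableSpace M] [BorelSpace M] in
theorem aemeasurable_chartDensity (c : M) : AEMeasurable
    (fun y ↦ ENNReal.ofReal (|Φ.frameDet c ((extChartAt (𝓡 7) c).symm y)| *
      chartPartition M c ((extChartAt (𝓡 7) c).symm y)))
    (volume.restrict (extChartAt (𝓡 7) c).target) :=
  ((Φ.continuousOn_chartIntegrand c (continuous_chartPartition c)).aemeasurable
    (isOpen_extChartAt_target c).measurableSet).ennreal_ofReal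

instance isFiniteMeasure_chartVol (c : M) : IsFiniteMeasure (Φ.chartVol c) := by
  rw [chartVol_eq]
  have := isFiniteMeasure_withDensity_ofReal (Φ.integrableOn_chartIntegrand c
    (continuous_chartPartition c) (tsupport_chartPartition c)).2
  infer_instance

theorem integral_chartVol (c : M) {h : M → ℝ} (hh : Continuous h) :
    ∫ x, h x ∂(Φ.chartVol c) = Φ.chartIntegral c fun x ↦ chartPartition M c x * h x := by
  rw [chartVol_eq, integral_map
    ((aemeasurable_extChartAt_symm c).mono_ac (withDensity_absolutelyContinuous _ _))
    hh.aestronglyMeasurable, integral_withDensity_eq_integral_toReal_smul₀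
    (Φ.aemeasurable_chartDensity c) (.of_forall fun _ ↦ ENNReal.ofReal_lt_top), chartIntegral]
  refine integral_congr_ae (.of_forall fun y ↦ ?_)
  simp only [smul_eq_mul]
  rw [ENNReal.toReal_ofReal (mul_nonneg (abs_nonneg _) ((chartPartition M).nonneg _ _)), mul_assoc]

-- By compactness only finitely many functions of the partition of unity are nonzero.
omit [BorelSpace M] in
theorem vol_eq_sum : Φ.vol = ∑ c ∈ chartIndex M, Φ.chartVol c := by
  change Measure.sum (fun c ↦ Φ.chartVol c) = _
  ext s hs
  rw [Measure.sum_apply _ hs, Measure.finsetSum_apply]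
  refine tsum_eq_sum fun c hc ↦ ?_
  simp [chartVol_eq, chartPartition_eq_zero hc]

instance isFiniteMeasure_vol : IsFiniteMeasure Φ.vol := by
  rw [vol_eq_sum]
  infer_instance

theorem integrable_vol {h : M → ℝ} (hh : Continuous h) : Integrable h Φ.vol :=
  hh.integrable_of_hasCompactSupport (isClosed_tsupport h).isCompact

theorem integral_vol {h : M → ℝ} (hh : Continuous h) : ∫ x, h x ∂Φ.vol =
    ∑ c ∈ chartIndex M, Φ.chartIntegral c fun x ↦ chartPartition M c x * h x := by
  rw [vol_eq_sum, integral_finsetSum_measure fun c _ ↦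
    hh.integrable_of_hasCompactSupport (isClosed_tsupport h).isCompact]
  exact Finset.sum_congr rfl fun c _ ↦ Φ.integral_chartVol c hh

/-- The integral of a function that is supported in a chart. -/
theorem integral_vol_eq_chartIntegral {h : M → ℝ} (hh : Continuous h) {c : M}
    (hs : tsupport h ⊆ (extChartAt (𝓡 7) c).source) :
    ∫ x, h x ∂Φ.vol = Φ.chartIntegral c h := by
  have h0 : ∀ x ∉ (extChartAt (𝓡 7) c).source, h x = 0 := fun x hx ↦
    image_eq_zero_of_notMem_tsupport fun h' ↦ hx (hs h')
  -- Each `ρ_{c'} h` vanishes outside both charts, so all terms can be integrated in the chart at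
  -- `c`, where `∑ ρ_{c'} = 1` recombines them.
  have h1 : ∀ c', Φ.chartIntegral c' (fun x ↦ chartPartition M c' x * h x) =
      Φ.chartIntegral c fun x ↦ chartPartition M c' x * h x := fun c' ↦ by
    refine Φ.chartIntegral_eq (fun x hx ↦ ?_) fun x hx ↦ ?_
    · rw [image_eq_zero_of_notMem_tsupport fun h' ↦ hx (tsupport_chartPartition c' h'), zero_mul]
    · rw [h0 x hx, mul_zero]
  rw [Φ.integral_vol hh]
  simp only [h1]
  simp only [chartIntegral]
  rw [← integral_finsetSum]
  · refine integral_congr_ae (.of_forall fun y ↦ ?_)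
    simp only
    rw [← Finset.mul_sum, ← Finset.sum_mul, sum_chartPartition, one_mul]
  · intro c' _
    exact Φ.integrableOn_chartIntegrand c ((continuous_chartPartition c').mul hh)
      ((tsupport_mul_subset_right).trans hs)

/-- A nonnegative continuous function with integral zero vanishes. -/
theorem eq_zero_of_integral_vol_eq_zero {h : M → ℝ} (hh : Continuous h) (hpos : ∀ x, 0 ≤ h x)
    (h0 : ∫ x, h x ∂Φ.vol = 0) (x : M) : h x = 0 := by
  obtain ⟨c, hc⟩ := (chartPartition M).exists_pos_of_mem (mem_univ x)
  have hcS : c ∈ chartIndex M := by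
    by_contra h'
    exact hc.ne' (chartPartition_eq_zero h' x)
  have hcont := (continuous_chartPartition c).mul hh
  have hsupp : tsupport (fun x ↦ chartPartition M c x * h x) ⊆ (extChartAt (𝓡 7) c).source :=
    (tsupport_mul_subset_left).trans (tsupport_chartPartition c)
  have hnn : ∀ c' y, 0 ≤ |Φ.frameDet c' ((extChartAt (𝓡 7) c').symm y)| *
      (chartPartition M c' ((extChartAt (𝓡 7) c').symm y) * h ((extChartAt (𝓡 7) c').symm y)) :=
    fun c' y ↦ mul_nonneg (abs_nonneg _) (mul_nonneg ((chartPartition M).nonneg _ _) (hpos _))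
  rw [Φ.integral_vol hh, Finset.sum_eq_zero_iff_of_nonneg
    fun c' _ ↦ integral_nonneg (hnn c')] at h0
  have h1 := h0 c hcS
  rw [chartIntegral, integral_eq_zero_iff_of_nonneg (hnn c)
    (Φ.integrableOn_chartIntegrand c hcont hsupp)] at h1
  -- Continuity on an open set upgrades vanishing almost everywhere to vanishing everywhere; at `x`
  -- the factors `|D|` and `ρ_c` are nonzero.
  have h2 := Measure.eqOn_open_of_ae_eq h1 (isOpen_extChartAt_target c)
    (Φ.continuousOn_chartIntegrand c hcont) continuousOn_const
  have hx : x ∈ (extChartAt (𝓡 7) c).source := by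
    by_contra h'
    exact hc.ne' (image_eq_zero_of_notMem_tsupport fun h'' ↦ h' (tsupport_chartPartition c h''))
  have h3 := h2 ((extChartAt (𝓡 7) c).map_source hx)
  simp only [(extChartAt (𝓡 7) c).left_inv hx, Pi.zero_apply, mul_eq_zero, abs_eq_zero] at h3
  rcases h3 with h3 | h3 | h3
  · exact absurd h3 (Φ.frameDet_ne_zero hx)
  · exact absurd h3 hc.ne'
  · exact h3

end G2Structure

end Volume

/-! ### The form `ℓ ∧ α ∧ α ∧ α` and the Leibniz rule for `α ∧ α ∧ α`. -/

section OneTopForm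

variable {V : Type*} [AddCommGroup V] [Module ℝ V]

/-- The seven-form `ℓ ∧ α ∧ α ∧ α`, up to normalization. -/
def oneTopForm (ℓ : V →ₗ[ℝ] ℝ) (α : V [⋀^Fin 2]→ₗ[ℝ] ℝ) : V [⋀^Fin 7]→ₗ[ℝ] ℝ :=
  MultilinearMap.alternatization (tensorForm (k := 5) (l := 2) (tensorForm (k := 3) (l := 2)
    (tensorForm (k := 1) (l := 2) (MultilinearMap.ofSubsingleton ℝ V ℝ (0 : Fin 1) ℓ)
      α.toMultilinearMap) α.toMultilinearMap) α.toMultilinearMap)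

theorem oneTopForm_apply (ℓ : V →ₗ[ℝ] ℝ) (α : V [⋀^Fin 2]→ₗ[ℝ] ℝ) (v : Fin 7 → V) :
    oneTopForm ℓ α v = ∑ σ : Equiv.Perm (Fin 7), (Equiv.Perm.sign σ : ℝ) *
      (ℓ (v (σ 0)) * α ![v (σ 1), v (σ 2)] * α ![v (σ 3), v (σ 4)] * α ![v (σ 5), v (σ 6)]) := by
  rw [oneTopForm, MultilinearMap.alternatization_apply]
  refine Finset.sum_congr rfl fun σ _ ↦ ?_
  rw [MultilinearMap.domDomCongr_apply, tensorForm_apply, tensorForm_apply, tensorForm_apply,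
    Units.smul_def, zsmul_eq_mul]
  congr 2
  · congr 1
    · congr 1
      change α _ = α _
      congr 1; ext i; fin_cases i <;> rfl
    · change α _ = α _
      congr 1; ext i; fin_cases i <;> rfl
  · change α _ = α _
    congr 1; ext i; fin_cases i <;> rfl

theorem oneTopForm_eq_det_mul (b : Module.Basis (Fin 7) ℝ V) (ℓ : V →ₗ[ℝ] ℝ)
    (α : V [⋀^Fin 2]→ₗ[ℝ] ℝ) (w : Fin 7 → V) :
    oneTopForm ℓ α w = b.det w * oneTopForm ℓ α b :=
  sevenForm_eq_det_mul b (oneTopForm ℓ α) w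

theorem sum_sign_mul_perm (τ : Equiv.Perm (Fin 7)) (F : Equiv.Perm (Fin 7) → ℝ) :
    ∑ σ : Equiv.Perm (Fin 7), (Equiv.Perm.sign σ : ℝ) * F (σ * τ) =
      (Equiv.Perm.sign τ : ℝ) * ∑ σ : Equiv.Perm (Fin 7), (Equiv.Perm.sign σ : ℝ) * F σ := by
  rw [← Equiv.sum_comp (Equiv.mulRight τ) fun σ ↦ (Equiv.Perm.sign σ : ℝ) * F σ, Finset.mul_sum]
  refine Finset.sum_congr rfl fun σ _ ↦ ?_
  rw [Equiv.coe_mulRight, Equiv.Perm.sign_mul]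
  rcases Int.units_eq_one_or (Equiv.Perm.sign τ) with h | h <;> simp [h]

/-- The combinatorics of `d(α ∧ α ∧ α) = 3 dα ∧ α ∧ α`. -/
theorem sum_sign_leibniz (d : Fin 7 → Fin 7 → Fin 7 → ℝ) (a : Fin 7 → Fin 7 → ℝ) :
    ∑ σ : Equiv.Perm (Fin 7), (Equiv.Perm.sign σ : ℝ) *
      (d (σ 0) (σ 1) (σ 2) * a (σ 3) (σ 4) * a (σ 5) (σ 6) +
        a (σ 1) (σ 2) * d (σ 0) (σ 3) (σ 4) * a (σ 5) (σ 6) +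
        a (σ 1) (σ 2) * a (σ 3) (σ 4) * d (σ 0) (σ 5) (σ 6)) =
    ∑ σ : Equiv.Perm (Fin 7), (Equiv.Perm.sign σ : ℝ) *
      ((d (σ 0) (σ 1) (σ 2) - d (σ 1) (σ 0) (σ 2) + d (σ 2) (σ 0) (σ 1)) *
        a (σ 3) (σ 4) * a (σ 5) (σ 6)) := by
  let F : Equiv.Perm (Fin 7) → ℝ := fun σ ↦ d (σ 0) (σ 1) (σ 2) * a (σ 3) (σ 4) * a (σ 5) (σ 6)
  -- The even `τ₁`, `τ₂` exchange the differentiated factor with the first one; `τ₃` (odd) and `τ₄`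
  -- (even) move the derivative index through the three terms of `dα`. Both sides become three times
  -- the signed sum of `F`.
  let τ₁ : Equiv.Perm (Fin 7) := Equiv.swap 1 3 * Equiv.swap 2 4
  let τ₂ : Equiv.Perm (Fin 7) := Equiv.swap 1 5 * Equiv.swap 2 6
  let τ₃ : Equiv.Perm (Fin 7) := Equiv.swap 0 1
  let τ₄ : Equiv.Perm (Fin 7) := Equiv.swap 0 1 * Equiv.swap 0 2
  have s₁ : Equiv.Perm.sign τ₁ = 1 := by decide +kernel
  have s₂ : Equiv.Perm.sign τ₂ = 1 := by decide +kernel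
  have s₃ : Equiv.Perm.sign τ₃ = -1 := by decide +kernel
  have s₄ : Equiv.Perm.sign τ₄ = 1 := by decide +kernel
  have h₁ := sum_sign_mul_perm τ₁ F
  have h₂ := sum_sign_mul_perm τ₂ F
  have h₃ := sum_sign_mul_perm τ₃ F
  have h₄ := sum_sign_mul_perm τ₄ F
  rw [s₁] at h₁
  rw [s₂] at h₂
  rw [s₃] at h₃
  rw [s₄] at h₄
  have e₁ : ∀ σ, F (σ * τ₁) = a (σ 1) (σ 2) * d (σ 0) (σ 3) (σ 4) * a (σ 5) (σ 6) := fun σ ↦ by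
    change d (σ (τ₁ 0)) (σ (τ₁ 1)) (σ (τ₁ 2)) * a (σ (τ₁ 3)) (σ (τ₁ 4)) * a (σ (τ₁ 5)) (σ (τ₁ 6)) = _
    rw [show τ₁ 0 = 0 by decide, show τ₁ 1 = 3 by decide, show τ₁ 2 = 4 by decide,
      show τ₁ 3 = 1 by decide, show τ₁ 4 = 2 by decide, show τ₁ 5 = 5 by decide,
      show τ₁ 6 = 6 by decide]
    ring
  have e₂ : ∀ σ, F (σ * τ₂) = a (σ 1) (σ 2) * a (σ 3) (σ 4) * d (σ 0) (σ 5) (σ 6) := fun σ ↦ by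
    change d (σ (τ₂ 0)) (σ (τ₂ 1)) (σ (τ₂ 2)) * a (σ (τ₂ 3)) (σ (τ₂ 4)) * a (σ (τ₂ 5)) (σ (τ₂ 6)) = _
    rw [show τ₂ 0 = 0 by decide, show τ₂ 1 = 5 by decide, show τ₂ 2 = 6 by decide,
      show τ₂ 3 = 3 by decide, show τ₂ 4 = 4 by decide, show τ₂ 5 = 1 by decide,
      show τ₂ 6 = 2 by decide]
    ring
  have e₃ : ∀ σ, F (σ * τ₃) = d (σ 1) (σ 0) (σ 2) * a (σ 3) (σ 4) * a (σ 5) (σ 6) := fun σ ↦ by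
    change d (σ (τ₃ 0)) (σ (τ₃ 1)) (σ (τ₃ 2)) * a (σ (τ₃ 3)) (σ (τ₃ 4)) * a (σ (τ₃ 5)) (σ (τ₃ 6)) = _
    rw [show τ₃ 0 = 1 by decide, show τ₃ 1 = 0 by decide, show τ₃ 2 = 2 by decide,
      show τ₃ 3 = 3 by decide, show τ₃ 4 = 4 by decide, show τ₃ 5 = 5 by decide,
      show τ₃ 6 = 6 by decide]
  have e₄ : ∀ σ, F (σ * τ₄) = d (σ 2) (σ 0) (σ 1) * a (σ 3) (σ 4) * a (σ 5) (σ 6) := fun σ ↦ by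
    change d (σ (τ₄ 0)) (σ (τ₄ 1)) (σ (τ₄ 2)) * a (σ (τ₄ 3)) (σ (τ₄ 4)) * a (σ (τ₄ 5)) (σ (τ₄ 6)) = _
    rw [show τ₄ 0 = 2 by decide, show τ₄ 1 = 0 by decide, show τ₄ 2 = 1 by decide,
      show τ₄ 3 = 3 by decide, show τ₄ 4 = 4 by decide, show τ₄ 5 = 5 by decide,
      show τ₄ 6 = 6 by decide]
  simp only [e₁] at h₁
  simp only [e₂] at h₂
  simp only [e₃] at h₃
  simp only [e₄] at h₄
  simp only [add_mul, sub_mul, mul_add, mul_sub, Finset.sum_add_distrib, Finset.sum_sub_distrib]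
  rw [h₁, h₂, h₃, h₄]
  push_cast
  ring

end OneTopForm

/-! ### Integration by parts in a vector space. -/

section LocalStokes

variable {E : Type*} [NormedAddCommGroup E] [NormedSpace ℝ E] [FiniteDimensional ℝ E]
  [MeasurableSpace E] [BorelSpace E] (μ : Measure E) [μ.IsAddHaarMeasure]

/-- The integral of a partial derivative of a compactly supported function vanishes, also after
multiplication by a locally constant sign. -/
theorem setIntegral_sign_mul_fderiv_eq_zero {T K : Set E} (hT : IsOpen T) (hK : IsCompact K)
    (hKT : K ⊆ T) {s G : E → ℝ} (hs : ContinuousOn s T) (hs1 : ∀ y ∈ T, s y ^ 2 = 1)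
    (hG : ContDiffOn ℝ 1 G T) (hG0 : ∀ y ∈ T \ K, G y = 0) (v : E) :
    IntegrableOn (fun y ↦ s y * fderiv ℝ G y v) T μ ∧
      ∫ y in T, s y * fderiv ℝ G y v ∂μ = 0 := by
  classical
  -- Both values are `±1`, and `s z * s y` stays positive near `y`, which excludes opposite signs.
  have hsloc : ∀ y ∈ T, ∀ᶠ z in nhds y, s z = s y := fun y hy ↦ by
    have h1 := ((hs.continuousAt (hT.mem_nhds hy)).mul continuousAt_const :
      ContinuousAt (fun z ↦ s z * s y) y)
    have h2 : (0 : ℝ) < s y * s y := by nlinarith [hs1 y hy]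
    filter_upwards [h1.eventually_const_lt h2, hT.mem_nhds hy] with z hz hzT
    have h3 : (s z - s y) * (s z + s y) = 0 := by linear_combination hs1 z hzT - hs1 y hy
    rcases mul_eq_zero.1 h3 with h | h
    · linarith
    · have h4 : 0 < s z * s y := hz
      rw [show s z = -s y by linarith] at h4
      linarith
  have hopen : ∀ y ∈ T \ K, T \ K ∈ nhds y := fun y hy ↦
    (hT.sdiff hK.isClosed).mem_nhds hy
  have hG'0 : ∀ y ∈ T \ K, fderiv ℝ G y = 0 := fun y hy ↦ by
    have : G =ᶠ[nhds y] fun _ ↦ 0 := by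
      filter_upwards [hopen y hy] with z hz using hG0 z hz
    rw [this.fderiv_eq, fderiv_fun_const, Pi.zero_apply]
  have hcont : ContinuousOn (fun y ↦ s y * fderiv ℝ G y v) T :=
    hs.mul ((hG.continuousOn_fderiv_of_isOpen hT le_rfl).clm_apply continuousOn_const)
  have hint : IntegrableOn (fun y ↦ s y * fderiv ℝ G y v) T μ :=
    ((hcont.mono hKT).integrableOn_compact hK).of_forall_sdiff_eq_zero hT.measurableSet
      fun y hy ↦ by rw [hG'0 y hy]; simp
  have hcont' : ContinuousOn (fun y ↦ s y * G y) T := hs.mul hG.continuousOn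
  have hint' : IntegrableOn (fun y ↦ s y * G y) T μ :=
    ((hcont'.mono hKT).integrableOn_compact hK).of_forall_sdiff_eq_zero
      hT.measurableSet fun y hy ↦ by rw [hG0 y hy, mul_zero]
  refine ⟨hint, ?_⟩
  -- Extension by zero is differentiable on the whole space: a point outside `T` has a neighbourhood
  -- missing the compact `K`, where `F` vanishes.
  set F : E → ℝ := T.indicator fun y ↦ s y * G y with hF
  have hderiv : ∀ y, HasFDerivAt F (T.indicator (fun y ↦ s y • fderiv ℝ G y) y) y := fun y ↦ by
    by_cases hy : y ∈ T
    · rw [indicator_of_mem hy]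
      have h1 : HasFDerivAt (fun z ↦ s y * G z) (s y • fderiv ℝ G y) y :=
        ((hG.contDiffAt (hT.mem_nhds hy)).differentiableAt (by simp)).hasFDerivAt.const_mul _
      refine h1.congr_of_eventuallyEq ?_
      filter_upwards [hsloc y hy, hT.mem_nhds hy] with z hz hzT
      rw [hF, indicator_of_mem hzT, hz]
    · rw [indicator_of_notMem hy]
      refine (hasFDerivAt_const (0 : ℝ) y).congr_of_eventuallyEq ?_
      filter_upwards [hK.isClosed.isOpen_compl.mem_nhds fun h ↦ hy (hKT h)] with z hz
      by_cases hzT : z ∈ T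
      · rw [hF, indicator_of_mem hzT, hG0 z ⟨hzT, hz⟩, mul_zero]
      · rw [hF, indicator_of_notMem hzT]
  have hF' : ∀ y, fderiv ℝ F y v = T.indicator (fun y ↦ s y * fderiv ℝ G y v) y := fun y ↦ by
    rw [(hderiv y).fderiv]
    by_cases hy : y ∈ T
    · simp [hy]
    · simp [hy]
  -- Integration by parts against the constant 1 leaves only the integral of the derivative of `F`.
  have key := integral_mul_fderiv_eq_neg_fderiv_mul_of_integrable (μ := μ) (f := fun _ ↦ (1 : ℝ))
    (g := F) (v := v) (by simp) (by
      simp only [one_mul, hF']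
      exact hint.integrable_indicator hT.measurableSet) (by
      simp only [one_mul]
      exact hint'.integrable_indicator hT.measurableSet) (by fun_prop)
    (fun y _ ↦ (hderiv y).differentiableAt)
  simpa [hF', integral_indicator hT.measurableSet] using key

end LocalStokes

/-! ### Stokes' theorem for `β ∧ β ∧ β` on the manifold. -/

section Stokes

variable {M : Type*} [TopologicalSpace M] [ChartedSpace E7 M]

/-- The differential of a real-valued function. -/
def differential (f : M → ℝ) (x : M) : TangentSpace (𝓡 7) x →L[ℝ] ℝ :=
  mfderiv (𝓡 7) 𝓘(ℝ, ℝ) f x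

theorem differential_eq_zero_of_notMem_tsupport {f : M → ℝ} {x : M} (hx : x ∉ tsupport f) :
    differential f x = 0 := by
  have h : f =ᶠ[nhds x] fun _ ↦ (0 : ℝ) := notMem_tsupport_iff_eventuallyEq.1 hx
  rw [differential, h.mfderiv_eq]
  exact mfderiv_const

variable [IsManifold (𝓡 7) ∞ M]

theorem contDiffOn_comp_symm {f : M → ℝ} (hf : ContMDiff (𝓡 7) 𝓘(ℝ, ℝ) ∞ f) (c : M) :
    ContDiffOn ℝ ∞ (fun y ↦ f ((extChartAt (𝓡 7) c).symm y)) (extChartAt (𝓡 7) c).target := by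
  rw [← contMDiffOn_iff_contDiffOn]
  exact hf.comp_contMDiffOn (contMDiffOn_extChartAt_symm c)

theorem fderiv_comp_symm {f : M → ℝ} (hf : ContMDiff (𝓡 7) 𝓘(ℝ, ℝ) ∞ f) {c : M} {y : E7}
    (hy : y ∈ (extChartAt (𝓡 7) c).target) :
    fderiv ℝ (fun y ↦ f ((extChartAt (𝓡 7) c).symm y)) y =
      (differential f ((extChartAt (𝓡 7) c).symm y)).comp
        (chartDerivInv c ((extChartAt (𝓡 7) c).symm y)) := by
  rw [← chartSymmDeriv_eq hy, ← mfderiv_eq_fderiv]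
  refine mfderiv_comp y (g := f) (f := (extChartAt (𝓡 7) c).symm) ?_ ?_
  · exact hf.contMDiffAt.mdifferentiableAt (by simp)
  · exact ((contMDiffOn_extChartAt_symm (n := ∞) c).contMDiffAt
      ((isOpen_extChartAt_target c).mem_nhds hy)).mdifferentiableAt (by simp)

theorem sum_differential {ι : Type*} (s : Finset ι) {f : ι → M → ℝ}
    (hf : ∀ i ∈ s, ContMDiff (𝓡 7) 𝓘(ℝ, ℝ) ∞ (f i)) (x : M) {a : ℝ}
    (ha : ∀ z, ∑ i ∈ s, f i z = a) (v : TangentSpace (𝓡 7) x) :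
    ∑ i ∈ s, differential (f i) x v = 0 := by
  have hy := mem_extChartAt_target (I := 𝓡 7) x
  have hT := (isOpen_extChartAt_target (I := 𝓡 7) x).mem_nhds hy
  have hd : ∀ i ∈ s, DifferentiableAt ℝ (fun y ↦ f i ((extChartAt (𝓡 7) x).symm y))
      (extChartAt (𝓡 7) x x) := fun i hi ↦
    ((contDiffOn_comp_symm (hf i hi) x).contDiffAt hT).differentiableAt (by simp)
  have h := fderiv_fun_sum hd
  simp only [ha, fderiv_fun_const, Pi.zero_apply] at h
  have hi : ∀ i ∈ s, differential (f i) x v = fderiv ℝ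
      (fun y ↦ f i ((extChartAt (𝓡 7) x).symm y)) (extChartAt (𝓡 7) x x) (chartDeriv x x v) :=
    fun i hi ↦ by
      rw [fderiv_comp_symm (hf i hi) hy, (extChartAt (𝓡 7) x).left_inv (mem_extChartAt_source x)]
      have := DFunLike.congr_fun (chartDerivInv_comp (mem_extChartAt_source (I := 𝓡 7) x)) v
      exact (congrArg (differential (f i) x) this).symm
  rw [Finset.sum_congr rfl hi, ← sum_apply, ← h]
  rfl

theorem fderiv_form_apply {k : ℕ} {η : E7 → E7 [⋀^Fin k]→L[ℝ] ℝ} {y : E7}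
    (hη : DifferentiableAt ℝ η y) (w : Fin k → E7) :
    DifferentiableAt ℝ (fun z ↦ η z w) y :=
  (ContinuousAlternatingMap.apply ℝ E7 ℝ w).differentiableAt.comp y hη

/-- The exterior derivative of a two-form in terms of the partial derivatives of its
coefficients. -/
theorem extDeriv_two_apply {η : E7 → E7 [⋀^Fin 2]→L[ℝ] ℝ} {y : E7}
    (hη : DifferentiableAt ℝ η y) (u v w : E7) :
    extDeriv η y ![u, v, w] = fderiv ℝ (fun z ↦ η z ![v, w]) y u -
      fderiv ℝ (fun z ↦ η z ![u, w]) y v + fderiv ℝ (fun z ↦ η z ![u, v]) y w := by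
  rw [extDeriv_apply hη, Fin.sum_univ_three]
  have e0 : (0 : Fin 3).removeNth ![u, v, w] = ![v, w] := by
    ext i : 1; fin_cases i <;> rfl
  have e1 : (1 : Fin 3).removeNth ![u, v, w] = ![u, w] := by
    ext i : 1; fin_cases i <;> rfl
  have e2 : (2 : Fin 3).removeNth ![u, v, w] = ![u, v] := by
    ext i : 1; fin_cases i <;> rfl
  rw [e0, e1, e2]
  simp
  ring

namespace G2Structure

variable (Φ : G2Structure M)

/-- The function `⋆(df ∧ β ∧ β ∧ β)`, up to normalization. -/
def exactTerm (β : DForm M 2) (f : M → ℝ) (x : M) : ℝ :=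
  oneTopForm (differential f x).toLinearMap (β x).toAlternatingMap (Φ.positive x).frame

theorem frameDet_mul_exactTerm (β : DForm M 2) {f : M → ℝ} (hf : ContMDiff (𝓡 7) 𝓘(ℝ, ℝ) ∞ f)
    {c : M} {y : E7} (hy : y ∈ (extChartAt (𝓡 7) c).target) :
    Φ.frameDet c ((extChartAt (𝓡 7) c).symm y) * Φ.exactTerm β f ((extChartAt (𝓡 7) c).symm y) =
      oneTopForm (fderiv ℝ (fun y ↦ f ((extChartAt (𝓡 7) c).symm y)) y).toLinearMap
        (β.inChart c y).toAlternatingMap stdBasis := by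
  rw [exactTerm, frameDet, ← oneTopForm_eq_det_mul, inChart_eq _ hy, fderiv_comp_symm hf hy,
    oneTopForm_apply, oneTopForm_apply]
  refine Finset.sum_congr rfl fun σ _ ↦ ?_
  congr 2
  · congr 1
    · congr 1
      change β _ _ = β _ _
      congr 1; ext i : 1; fin_cases i <;> rfl
    · change β _ _ = β _ _
      congr 1; ext i : 1; fin_cases i <;> rfl
  · change β _ _ = β _ _
    congr 1; ext i : 1; fin_cases i <;> rfl

theorem continuous_exactTerm {β : DForm M 2} (hβ : β.IsSmooth) {f : M → ℝ}
    (hf : ContMDiff (𝓡 7) 𝓘(ℝ, ℝ) ∞ f) : Continuous (Φ.exactTerm β f) := by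
  refine Φ.continuous_of_frameDet_mul fun c ↦ ?_
  refine ContinuousOn.congr ?_ fun y hy ↦ Φ.frameDet_mul_exactTerm β hf hy
  have hfc := ((contDiffOn_comp_symm hf c).continuousOn_fderiv_of_isOpen
    (isOpen_extChartAt_target c) (by simp))
  have hb := hβ.continuousOn c
  simp only [oneTopForm_apply]
  exact continuousOn_finsetSum _ fun σ _ ↦ continuousOn_const.mul
    ((((hfc.clm_apply continuousOn_const).mul (continuousOn_form_apply hb _)).mul
      (continuousOn_form_apply hb _)).mul (continuousOn_form_apply hb _))

theorem sum_exactTerm {ι : Type*} (s : Finset ι) (β : DForm M 2) {f : ι → M → ℝ}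
    (hf : ∀ i ∈ s, ContMDiff (𝓡 7) 𝓘(ℝ, ℝ) ∞ (f i)) {a : ℝ} (ha : ∀ z, ∑ i ∈ s, f i z = a)
    (x : M) : ∑ i ∈ s, Φ.exactTerm β (f i) x = 0 := by
  simp only [exactTerm, oneTopForm_apply]
  rw [Finset.sum_comm]
  refine Finset.sum_eq_zero fun σ _ ↦ ?_
  rw [← Finset.mul_sum, ← Finset.sum_mul, ← Finset.sum_mul, ← Finset.sum_mul]
  have := sum_differential s hf x ha ((Φ.positive x).frame (σ 0))
  refine Eq.trans (congrArg _ (congrArg (· * _) (congrArg (· * _) (congrArg (· * _) this)))) ?_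
  simp

-- Off the closed support of `f` both `f` and `df` vanish, which keeps the localized integrand
-- inside one chart.
omit [IsManifold (𝓡 7) ∞ M] in
theorem tsupport_exactTerm_add_subset (β : DForm M 2) (f h : M → ℝ) :
    tsupport (fun x ↦ Φ.exactTerm β f x + f x * h x) ⊆ tsupport f := by
  refine closure_minimal (fun x hx ↦ ?_) (isClosed_tsupport f)
  by_contra h'
  apply hx
  simp only
  rw [image_eq_zero_of_notMem_tsupport h', exactTerm,
    differential_eq_zero_of_notMem_tsupport h', oneTopForm_apply]
  simp

/-- The coordinate expression of `d(f β ∧ β ∧ β)`. -/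
theorem frameDet_mul_exactTerm_add {β : DForm M 2} (hβ : β.IsSmooth) (hexact : Φ.form = β.d)
    {f : M → ℝ} (hf : ContMDiff (𝓡 7) 𝓘(ℝ, ℝ) ∞ f) {c : M} {y : E7}
    (hy : y ∈ (extChartAt (𝓡 7) c).target) :
    Φ.frameDet c ((extChartAt (𝓡 7) c).symm y) *
      (Φ.exactTerm β f ((extChartAt (𝓡 7) c).symm y) +
        f ((extChartAt (𝓡 7) c).symm y) * Φ.cubic β ((extChartAt (𝓡 7) c).symm y)) =
    ∑ σ : Equiv.Perm (Fin 7), (Equiv.Perm.sign σ : ℝ) *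
      fderiv ℝ (fun z ↦ f ((extChartAt (𝓡 7) c).symm z) *
        (β.inChart c z ![stdBasis (σ 1), stdBasis (σ 2)] *
          β.inChart c z ![stdBasis (σ 3), stdBasis (σ 4)] *
          β.inChart c z ![stdBasis (σ 5), stdBasis (σ 6)])) y (stdBasis (σ 0)) := by
  have hT := (isOpen_extChartAt_target (I := 𝓡 7) c).mem_nhds hy
  have hbd : DifferentiableAt ℝ (β.inChart c) y :=
    ((hβ c).contDiffAt hT).differentiableAt (by simp)
  have hfd : DifferentiableAt ℝ (fun z ↦ f ((extChartAt (𝓡 7) c).symm z)) y :=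
    ((contDiffOn_comp_symm hf c).contDiffAt hT).differentiableAt (by simp)
  rw [mul_add, Φ.frameDet_mul_exactTerm β hf hy, mul_left_comm, cubic,
    ← Φ.topForm_inChart β β hy, hexact, inChart_d hβ hy, topForm_apply, oneTopForm_apply]
  set a : Fin 7 → Fin 7 → ℝ := fun i j ↦ β.inChart c y ![stdBasis i, stdBasis j] with ha
  set d : Fin 7 → Fin 7 → Fin 7 → ℝ := fun k i j ↦
    fderiv ℝ (fun z ↦ β.inChart c z ![stdBasis i, stdBasis j]) y (stdBasis k) with hd
  have hext : ∀ i j k, extDeriv (β.inChart c) y ![stdBasis i, stdBasis j, stdBasis k] =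
      d i j k - d j i k + d k i j := fun i j k ↦ extDeriv_two_apply hbd _ _ _
  have h1 := sum_sign_leibniz d a
  have h2 : ∀ σ : Equiv.Perm (Fin 7), fderiv ℝ (fun z ↦ f ((extChartAt (𝓡 7) c).symm z) *
        (β.inChart c z ![stdBasis (σ 1), stdBasis (σ 2)] *
          β.inChart c z ![stdBasis (σ 3), stdBasis (σ 4)] *
          β.inChart c z ![stdBasis (σ 5), stdBasis (σ 6)])) y (stdBasis (σ 0)) =
      fderiv ℝ (fun z ↦ f ((extChartAt (𝓡 7) c).symm z)) y (stdBasis (σ 0)) *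
        a (σ 1) (σ 2) * a (σ 3) (σ 4) * a (σ 5) (σ 6) +
      f ((extChartAt (𝓡 7) c).symm y) * (d (σ 0) (σ 1) (σ 2) * a (σ 3) (σ 4) * a (σ 5) (σ 6) +
        a (σ 1) (σ 2) * d (σ 0) (σ 3) (σ 4) * a (σ 5) (σ 6) +
        a (σ 1) (σ 2) * a (σ 3) (σ 4) * d (σ 0) (σ 5) (σ 6)) := fun σ ↦ by
    have k1 := (fderiv_form_apply hbd ![stdBasis (σ 1), stdBasis (σ 2)]).hasFDerivAt
    have k2 := (fderiv_form_apply hbd ![stdBasis (σ 3), stdBasis (σ 4)]).hasFDerivAt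
    have k3 := (fderiv_form_apply hbd ![stdBasis (σ 5), stdBasis (σ 6)]).hasFDerivAt
    have k := hfd.hasFDerivAt.fun_mul ((k1.fun_mul k2).fun_mul k3)
    rw [k.fderiv]
    simp only [add_apply, smul_apply, smul_eq_mul, ha, hd]
    ring
  simp only [h2, mul_add (Equiv.Perm.sign _ : ℝ) (_ * _ * _ * _), Finset.sum_add_distrib]
  congr 1
  simp only [mul_left_comm (Equiv.Perm.sign _ : ℝ) (f _), ← Finset.mul_sum]
  rw [h1]
  congr 1
  refine Finset.sum_congr rfl fun σ _ ↦ ?_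
  congr 2
  congr 1
  exact hext _ _ _

variable [T2Space M] [CompactSpace M]

omit [T2Space M] in
/-- Stokes' theorem in a chart, for the form `f β ∧ β ∧ β`. -/
theorem chartIntegral_exactTerm_add {β : DForm M 2} (hβ : β.IsSmooth) (hexact : Φ.form = β.d)
    {f : M → ℝ} (hf : ContMDiff (𝓡 7) 𝓘(ℝ, ℝ) ∞ f) {c : M}
    (hc : tsupport f ⊆ (extChartAt (𝓡 7) c).source) :
    Φ.chartIntegral c (fun x ↦ Φ.exactTerm β f x + f x * Φ.cubic β x) = 0 := by
  have hD : ∀ y ∈ (extChartAt (𝓡 7) c).target,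
      Φ.frameDet c ((extChartAt (𝓡 7) c).symm y) ≠ 0 := fun y hy ↦
    Φ.frameDet_ne_zero ((extChartAt (𝓡 7) c).map_target hy)
  -- The sign comparing the chart with the orientation of `φ`. It converts the density `|D|` of the
  -- measure into the factor `D` of a seven-form, so charts need not be oriented.
  set s : E7 → ℝ := fun y ↦ |Φ.frameDet c ((extChartAt (𝓡 7) c).symm y)| /
    Φ.frameDet c ((extChartAt (𝓡 7) c).symm y) with hs
  have hscont : ContinuousOn s (extChartAt (𝓡 7) c).target :=
    (Φ.continuousOn_frameDet_symm c).abs.div (Φ.continuousOn_frameDet_symm c) hD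
  have hs1 : ∀ y ∈ (extChartAt (𝓡 7) c).target, s y ^ 2 = 1 := fun y hy ↦ by
    rw [hs, div_pow, sq_abs, div_self (pow_ne_zero 2 (hD y hy))]
  have hKT : extChartAt (𝓡 7) c '' tsupport f ⊆ (extChartAt (𝓡 7) c).target := by
    rintro _ ⟨x, hx, rfl⟩
    exact (extChartAt (𝓡 7) c).map_source (hc hx)
  have hfc := contDiffOn_comp_symm hf c
  have hbc : ∀ w, ContDiffOn ℝ ∞ (fun z ↦ β.inChart c z w) (extChartAt (𝓡 7) c).target := fun w ↦
    (ContinuousAlternatingMap.apply ℝ E7 ℝ w).contDiff.comp_contDiffOn (hβ c)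
  have key : ∀ σ : Equiv.Perm (Fin 7), _ := fun σ ↦
    setIntegral_sign_mul_fderiv_eq_zero (volume : Measure E7) (isOpen_extChartAt_target c)
      (isCompact_image_tsupport c hc) hKT hscont hs1
      (G := fun z ↦ f ((extChartAt (𝓡 7) c).symm z) *
        (β.inChart c z ![stdBasis (σ 1), stdBasis (σ 2)] *
          β.inChart c z ![stdBasis (σ 3), stdBasis (σ 4)] *
          β.inChart c z ![stdBasis (σ 5), stdBasis (σ 6)]))
      ((hfc.mul (((hbc _).mul (hbc _)).mul (hbc _))).of_le (by simp))
      (fun y hy ↦ by rw [eq_zero_of_notMem_image_tsupport hy.1 hy.2, zero_mul])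
      (stdBasis (σ 0))
  rw [chartIntegral]
  trans ∫ y in (extChartAt (𝓡 7) c).target, ∑ σ : Equiv.Perm (Fin 7), (Equiv.Perm.sign σ : ℝ) *
      (s y * fderiv ℝ (fun z ↦ f ((extChartAt (𝓡 7) c).symm z) *
        (β.inChart c z ![stdBasis (σ 1), stdBasis (σ 2)] *
          β.inChart c z ![stdBasis (σ 3), stdBasis (σ 4)] *
          β.inChart c z ![stdBasis (σ 5), stdBasis (σ 6)])) y (stdBasis (σ 0)))
  · refine setIntegral_congr_fun (isOpen_extChartAt_target c).measurableSet fun y hy ↦ ?_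
    simp only [mul_left_comm _ (s y), ← Finset.mul_sum]
    rw [← Φ.frameDet_mul_exactTerm_add hβ hexact hf hy, ← mul_assoc, hs,
      div_mul_cancel₀ _ (hD y hy)]
  · rw [integral_finsetSum _ fun σ _ ↦ (key σ).1.const_mul _]
    refine Finset.sum_eq_zero fun σ _ ↦ ?_
    rw [integral_const_mul, (key σ).2, mul_zero]

variable [MeasurableSpace M] [BorelSpace M]

/-- The integral of `d(β ∧ β ∧ β) = 3 φ ∧ β ∧ β` vanishes. -/
theorem integral_cubic_eq_zero {β : DForm M 2} (hβ : β.IsSmooth) (hexact : Φ.form = β.d) :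
    ∫ x, Φ.cubic β x ∂Φ.vol = 0 := by
  have hρ : ∀ c, ContMDiff (𝓡 7) 𝓘(ℝ, ℝ) ∞ (chartPartition M c) := fun c ↦
    (chartPartition M c).contMDiff
  have hcont : ∀ c, Continuous fun x ↦
      Φ.exactTerm β (chartPartition M c) x + chartPartition M c x * Φ.cubic β x := fun c ↦
    (Φ.continuous_exactTerm hβ (hρ c)).add ((continuous_chartPartition c).mul
      (Φ.continuous_cubic hβ))
  -- The terms with `dρ_c` add up to zero because `∑ ρ_c` is constant.
  have hsum : ∀ x, Φ.cubic β x = ∑ c ∈ chartIndex M,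
      (Φ.exactTerm β (chartPartition M c) x + chartPartition M c x * Φ.cubic β x) := fun x ↦ by
    rw [Finset.sum_add_distrib, Φ.sum_exactTerm (chartIndex M) β (fun c _ ↦ hρ c)
      sum_chartPartition, ← Finset.sum_mul, sum_chartPartition, one_mul, zero_add]
  rw [integral_congr_ae (.of_forall hsum), integral_finsetSum _ fun c _ ↦
    Φ.integrable_vol (hcont c)]
  refine Finset.sum_eq_zero fun c _ ↦ ?_
  rw [Φ.integral_vol_eq_chartIntegral (hcont c) ((Φ.tsupport_exactTerm_add_subset β _ _).trans
    (tsupport_chartPartition c))]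
  exact Φ.chartIntegral_exactTerm_add hβ hexact (hρ c) (tsupport_chartPartition c)

end G2Structure

end Stokes

/-! ### The decomposition of two-forms and the norm identity. -/

section Decomposition

variable {V : Type*} [AddCommGroup V] [Module ℝ V]

theorem frameFormInner_contractProj_comm (φ : V [⋀^Fin 3]→ₗ[ℝ] ℝ) (b : Module.Basis (Fin 7) ℝ V)
    (α γ : V [⋀^Fin 2]→ₗ[ℝ] ℝ) :
    frameFormInner b (contractProj φ b α) γ = frameFormInner b (contractProj φ b γ) α := by
  rw [frameFormInner_contractProj, frameFormInner_contractProj]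
  exact Finset.sum_congr rfl fun m _ ↦ mul_comm _ _

theorem contractProj_apply (φ : V [⋀^Fin 3]→ₗ[ℝ] ℝ) (b : Module.Basis (Fin 7) ℝ V)
    (α : V [⋀^Fin 2]→ₗ[ℝ] ℝ) (v : Fin 2 → V) : contractProj φ b α v =
      ∑ m, frameFormInner b (contract φ (b m)) α * φ (Matrix.vecCons (b m) v) := by
  rw [contractProj, alternatingMap_sum_apply]
  rfl

theorem frameFormInner_zero_left (b : Module.Basis (Fin 7) ℝ V) (γ : V [⋀^Fin 2]→ₗ[ℝ] ℝ) :
    frameFormInner b 0 γ = 0 := by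
  rw [← frameFormBilin_apply, map_zero, LinearMap.zero_apply]

namespace IsAdaptedFrame

variable {φ : V [⋀^Fin 3]→ₗ[ℝ] ℝ} {b : Module.Basis (Fin 7) ℝ V} (h : IsAdaptedFrame φ b)
  {α₇ α₁₄ : V [⋀^Fin 2]→ₗ[ℝ] ℝ}

include h

/-- Eigenvectors of the self-adjoint `contractProj` for the eigenvalues 3 and 0 are orthogonal, so
both quadratic forms are diagonal, the second with weights `3 - 1` and `0 - 1`. -/
theorem frameFormInner_add_self (h₇ : contractProj φ b α₇ = (3 : ℝ) • α₇)
    (h₁₄ : contractProj φ b α₁₄ = 0) :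
    frameFormInner b (α₇ + α₁₄) (α₇ + α₁₄) =
      frameFormInner b α₇ α₇ + frameFormInner b α₁₄ α₁₄ ∧
    topForm φ (α₇ + α₁₄) (α₇ + α₁₄) b =
      24 * (2 * frameFormInner b α₇ α₇ - frameFormInner b α₁₄ α₁₄) := by
  have horth : frameFormInner b α₇ α₁₄ = 0 := by
    have := frameFormInner_contractProj_comm φ b α₇ α₁₄
    rw [h₇, h₁₄, frameFormInner_zero_left, ← frameFormBilin_apply, map_smul, LinearMap.smul_apply,
      frameFormBilin_apply, smul_eq_mul] at this
    linarith
  have hsum : frameFormInner b (α₇ + α₁₄) (α₇ + α₁₄) =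
      frameFormInner b α₇ α₇ + frameFormInner b α₁₄ α₁₄ := by
    have horth' := (frameFormInner_comm b α₁₄ α₇).trans horth
    simp only [← frameFormBilin_apply] at horth horth' ⊢
    rw [map_add, map_add, LinearMap.add_apply, LinearMap.add_apply, horth, horth']
    ring
  refine ⟨hsum, ?_⟩
  rw [h.topForm_basis, hsum, contractProj_add, h₇, h₁₄, add_zero]
  simp only [← frameFormBilin_apply] at horth ⊢
  rw [map_smul, LinearMap.smul_apply, map_add, horth, smul_eq_mul]
  ring

end IsAdaptedFrame

variable {M : Type*} [TopologicalSpace M] [ChartedSpace E7 M]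

namespace G2Structure

variable (Φ : G2Structure M)

theorem memLambda7_iff {x : M} {α : TangentSpace (𝓡 7) x [⋀^Fin 2]→ₗ[ℝ] ℝ} :
    (Φ.positive x).MemLambda7 α ↔
      contractProj (Φ.form x).toAlternatingMap (Φ.positive x).frame α = (3 : ℝ) • α :=
  (Φ.isAdaptedFrame x).mem_seven_iff

theorem memLambda14_iff {x : M} {α : TangentSpace (𝓡 7) x [⋀^Fin 2]→ₗ[ℝ] ℝ} :
    (Φ.positive x).MemLambda14 α ↔
      contractProj (Φ.form x).toAlternatingMap (Φ.positive x).frame α = 0 :=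
  (Φ.isAdaptedFrame x).mem_fourteen_iff

/-- The component of a two-form in `Λ²₇`. -/
def projSeven (β : DForm M 2) : DForm M 2 := fun x ↦
  { (3⁻¹ : ℝ) • contractProj (Φ.form x).toAlternatingMap (Φ.positive x).frame
      (β x).toAlternatingMap with
    cont := by
      have hv (m : Fin 7) : Continuous fun v : Fin 2 → TangentSpace (𝓡 7) x ↦
          (Matrix.vecCons ((Φ.positive x).frame m) v : Fin 3 → TangentSpace (𝓡 7) x) :=
        continuous_const.matrixVecCons continuous_id
      have hsum : Continuous fun v : Fin 2 → TangentSpace (𝓡 7) x ↦ (3⁻¹ : ℝ) * ∑ m,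
          frameFormInner (Φ.positive x).frame (contract (Φ.form x).toAlternatingMap
            ((Φ.positive x).frame m)) (β x).toAlternatingMap *
          Φ.form x (Matrix.vecCons ((Φ.positive x).frame m) v) :=
        continuous_const.mul (continuous_finsetSum Finset.univ fun m _ ↦
          continuous_const.mul ((Φ.form x).cont.comp (hv m)))
      refine hsum.congr fun v ↦ ?_
      exact (congrArg ((3⁻¹ : ℝ) * ·) (contractProj_apply _ _ _ v)).symm }

theorem projSeven_toAlternatingMap (β : DForm M 2) (x : M) :
    (Φ.projSeven β x).toAlternatingMap = (3⁻¹ : ℝ) • contractProj (Φ.form x).toAlternatingMap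
      (Φ.positive x).frame (β x).toAlternatingMap := rfl

theorem isDecomposition_projSeven (β : DForm M 2) :
    Φ.IsDecomposition β (Φ.projSeven β) (β - Φ.projSeven β) where
  mem_seven x := by
    rw [memLambda7_iff, projSeven_toAlternatingMap, contractProj_smul,
      (Φ.isAdaptedFrame x).contractProj_contractProj, smul_comm]
  mem_fourteen x := by
    have e : ((β - Φ.projSeven β) x).toAlternatingMap = (β x).toAlternatingMap +
        (-1 : ℝ) • (Φ.projSeven β x).toAlternatingMap := by
      ext v
      change β x v - Φ.projSeven β x v = β x v + (-1 : ℝ) • Φ.projSeven β x v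
      simp [sub_eq_add_neg]
    rw [memLambda14_iff, e, projSeven_toAlternatingMap, contractProj_add, contractProj_smul,
      contractProj_smul, (Φ.isAdaptedFrame x).contractProj_contractProj]
    module
  add_eq := (add_sub_cancel _ _).symm

variable {Φ} {β β₇ β₁₄ : DForm M 2}

namespace IsDecomposition

theorem toAlternatingMap_eq (h : Φ.IsDecomposition β β₇ β₁₄) (x : M) :
    (β x).toAlternatingMap = (β₇ x).toAlternatingMap + (β₁₄ x).toAlternatingMap := by
  rw [h.add_eq]
  rfl

/-- Applying `contractProj` to the sum kills the component in `Λ²₁₄` and multiplies the other by 3.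
-/
theorem eq_projSeven (h : Φ.IsDecomposition β β₇ β₁₄) : β₇ = Φ.projSeven β := by
  funext x
  refine ContinuousAlternatingMap.toAlternatingMap_injective ?_
  have h₇ := Φ.memLambda7_iff.1 (h.mem_seven x)
  have h₁₄ := Φ.memLambda14_iff.1 (h.mem_fourteen x)
  rw [projSeven_toAlternatingMap, h.toAlternatingMap_eq x, contractProj_add, h₇, h₁₄, add_zero,
    smul_smul, inv_mul_cancel₀ three_ne_zero, one_smul]

theorem normSq_add (h : Φ.IsDecomposition β β₇ β₁₄) (x : M) :
    Φ.normSq β x = Φ.normSq β₇ x + Φ.normSq β₁₄ x := by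
  have := ((Φ.isAdaptedFrame x).frameFormInner_add_self (Φ.memLambda7_iff.1 (h.mem_seven x))
    (Φ.memLambda14_iff.1 (h.mem_fourteen x))).1
  rwa [← h.toAlternatingMap_eq] at this

theorem cubic_eq (h : Φ.IsDecomposition β β₇ β₁₄) (x : M) :
    Φ.cubic β x = 24 * (2 * Φ.normSq β₇ x - Φ.normSq β₁₄ x) := by
  have := ((Φ.isAdaptedFrame x).frameFormInner_add_self (Φ.memLambda7_iff.1 (h.mem_seven x))
    (Φ.memLambda14_iff.1 (h.mem_fourteen x))).2
  rwa [← h.toAlternatingMap_eq] at this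

end IsDecomposition

theorem normSq_nonneg (β : DForm M 2) (x : M) : 0 ≤ Φ.normSq β x :=
  frameFormInner_self_nonneg _ _

theorem normSq_zero (x : M) : Φ.normSq (0 : DForm M 2) x = 0 :=
  frameFormInner_zero_left _ _

theorem eq_zero_of_normSq_eq_zero (h : ∀ x, Φ.normSq β x = 0) : β = 0 := by
  funext x
  exact ContinuousAlternatingMap.toAlternatingMap_injective (eq_zero_of_frameFormInner_self _ (h x))

theorem form_ne_zero (x : M) : Φ.form x ≠ 0 := fun h ↦ by
  have h1 := (Φ.isAdaptedFrame x).apply_basis 0 1 2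
  have h2 : modelValue 0 1 2 = 1 := by decide +kernel
  rw [h2] at h1
  have h3 := DFunLike.congr_fun h ![(Φ.positive x).frame 0, (Φ.positive x).frame 1,
    (Φ.positive x).frame 2]
  have h4 : (0 : ℝ) = 1 := h3.symm.trans (h1.trans Int.cast_one)
  exact zero_ne_one h4

variable [IsManifold (𝓡 7) ∞ M]

omit [IsManifold (𝓡 7) ∞ M] in
theorem d_zero (x : M) : DForm.d (0 : DForm M 2) x = 0 := by
  have h : DForm.inChart (0 : DForm M 2) x = fun _ ↦ 0 := by
    funext y
    rfl
  have h0 : extDeriv (fun _ : E7 ↦ (0 : E7 [⋀^Fin 2]→L[ℝ] ℝ)) (extChartAt (𝓡 7) x x) = 0 := by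
    rw [extDeriv, fderiv_fun_const, Pi.zero_apply]
    exact map_zero (ContinuousAlternatingMap.alternatizeUncurryFinCLM ℝ E7 ℝ)
  rw [DForm.d, h, h0]
  rfl

namespace IsDecomposition

/-- Regularity of the component itself is not needed: `|β|² = |β₇|² + |β₁₄|²` and `cubic / 24 =
2|β₇|² - |β₁₄|²` are continuous and add up to `3|β₇|²`. -/
theorem continuous_normSq_seven (h : Φ.IsDecomposition β β₇ β₁₄) (hβ : β.IsSmooth) :
    Continuous (Φ.normSq β₇) := by
  have : Φ.normSq β₇ = fun x ↦ (Φ.normSq β x + Φ.cubic β x / 24) / 3 := funext fun x ↦ by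
    linear_combination -(h.normSq_add x) / 3 - h.cubic_eq x / 72
  rw [this]
  exact ((Φ.continuous_normSq hβ).add ((Φ.continuous_cubic hβ).div_const _)).div_const _

theorem continuous_normSq_fourteen (h : Φ.IsDecomposition β β₇ β₁₄) (hβ : β.IsSmooth) :
    Continuous (Φ.normSq β₁₄) := by
  have : Φ.normSq β₁₄ = fun x ↦ Φ.normSq β x - Φ.normSq β₇ x := funext fun x ↦ by
    rw [h.normSq_add x]; ring
  rw [this]
  exact (Φ.continuous_normSq hβ).sub (h.continuous_normSq_seven hβ)

variable [T2Space M] [CompactSpace M] [MeasurableSpace M] [BorelSpace M]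

theorem two_mul_l2NormSq (h : Φ.IsDecomposition β β₇ β₁₄) (hβ : β.IsSmooth)
    (hexact : Φ.form = β.d) : 2 * Φ.l2NormSq β₇ = Φ.l2NormSq β₁₄ := by
  have h0 := Φ.integral_cubic_eq_zero hβ hexact
  have i₇ := Φ.integrable_vol (h.continuous_normSq_seven hβ)
  have i₁₄ := Φ.integrable_vol (h.continuous_normSq_fourteen hβ)
  simp only [h.cubic_eq] at h0
  rw [integral_const_mul, integral_sub (i₇.const_mul 2) i₁₄, integral_const_mul] at h0
  rw [l2NormSq, l2NormSq]
  linarith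

/-- By the norm identity both norms would vanish, so `β = 0` by continuity and positivity, and `φ =
d β` would be zero at some point. -/
theorem l2NormSq_ne_zero [Nonempty M] (h : Φ.IsDecomposition β β₇ β₁₄) (hβ : β.IsSmooth)
    (hexact : Φ.form = β.d) : Φ.l2NormSq β₇ ≠ 0 := fun h₇ ↦ by
  have h₁₄ : Φ.l2NormSq β₁₄ = 0 := by rw [← h.two_mul_l2NormSq hβ hexact, h₇, mul_zero]
  have z₇ := Φ.eq_zero_of_integral_vol_eq_zero (h.continuous_normSq_seven hβ)
    (normSq_nonneg β₇) h₇
  have z₁₄ := Φ.eq_zero_of_integral_vol_eq_zero (h.continuous_normSq_fourteen hβ)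
    (normSq_nonneg β₁₄) h₁₄
  have hz : β = 0 := eq_zero_of_normSq_eq_zero fun x ↦ by rw [h.normSq_add, z₇, z₁₄, add_zero]
  obtain ⟨x⟩ := ‹Nonempty M›
  exact Φ.form_ne_zero x (by rw [hexact, hz, d_zero])

end IsDecomposition

theorem l2NormSq_zero [T2Space M] [CompactSpace M] [MeasurableSpace M] [BorelSpace M] :
    Φ.l2NormSq (0 : DForm M 2) = 0 := by
  simp [l2NormSq, normSq_zero]

end G2Structure

end Decomposition

end G2

end

theorem mainTheorem2 {M : Type*} [TopologicalSpace M] [ChartedSpace G2.E7 M]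
    [IsManifold (𝓡 7) ∞ M] [CompactSpace M] [T2Space M] [Nonempty M]
    [MeasurableSpace M] [BorelSpace M]
    (Φ : G2.G2Structure M) (β : G2.DForm M 2) (hβ : G2.DForm.IsSmooth β) (hexact : Φ.form = G2.DForm.d β) :
    (∃! p : G2.DForm M 2 × G2.DForm M 2, Φ.IsDecomposition β p.1 p.2) ∧
    ∀ β₇ β₁₄ : G2.DForm M 2, Φ.IsDecomposition β β₇ β₁₄ →
      Integrable (Φ.normSq β₇) Φ.vol ∧ Integrable (Φ.normSq β₁₄) Φ.vol ∧
      2 * Φ.l2NormSq β₇ = Φ.l2NormSq β₁₄ ∧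
      β₇ ≠ 0 ∧ β₁₄ ≠ 0 := by
  refine ⟨⟨(Φ.projSeven β, β - Φ.projSeven β), Φ.isDecomposition_projSeven β, ?_⟩, ?_⟩
  · rintro ⟨β₇, β₁₄⟩ h
    have h₇ : β₇ = Φ.projSeven β := h.eq_projSeven
    have h₁₄ : β₁₄ = β - β₇ := eq_sub_of_add_eq' h.add_eq.symm
    rw [h₁₄, h₇]
  · intro β₇ β₁₄ h
    refine ⟨Φ.integrable_vol (h.continuous_normSq_seven hβ),
      Φ.integrable_vol (h.continuous_normSq_fourteen hβ), h.two_mul_l2NormSq hβ hexact, ?_, ?_⟩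
    · rintro rfl
      exact h.l2NormSq_ne_zero hβ hexact G2.G2Structure.l2NormSq_zero
    · rintro rfl
      -- The norm identity reduces the vanishing of the second component to that of the first.
      refine h.l2NormSq_ne_zero hβ hexact ?_
      have h2 := h.two_mul_l2NormSq hβ hexact
      rw [G2.G2Structure.l2NormSq_zero] at h2
      linarith
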